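/- **Lemma (Preservation for System DR).** Let $\Sigma_0$ be a well-formed signature of System DR, $R$ a role, $a,a'$ terms with $\vDash a\leadsto_R a'$, $\Gamma$ a context and $A$ a term. If $\Gamma\vDash a:A$, then $\Gamma\vDash a':A$ and, for every set $\Delta$ of coercion variables, $\Gamma;\Delta\vDash a\equiv_R a':A$. No restriction is placed on $\Gamma$: terms may be open, and $\Gamma$ may contain contradictory equality assumptions. The system is the following. *Syntax.* Roles $R$ are $\mathsf{Nom}\le\mathsf{Rep}$, with minimum $\wedge$. Relevance $\rho::=+\mid-$; flags $\nu::=R\mid\rho$ and $\upsilon::=\nu\mid\bullet$. Terms and types, up to renaming of bound variables: $a,b,A,B::=\star\mid x\mid F\mid\lambda^\rho x.b\mid a\,b^\nu\mid\Pi^\rho x{:}A\to B\mid\Box\mid\Lambda c.b\mid a\,\bullet\mid\forall c{:}\phi.B\mid\mathsf{case}\ a\ \mathsf{of}\ F\,\overline\upsilon\to b_1\,\|\,\_\to b_2$, with constraints $\phi::=a\sim_R b:A$. Contexts $\Gamma$ list declarations $x:A$ and $c:\phi$; $\widetilde\Gamma$ is the set of coercion variables of $\Gamma$. A signature lists declarations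 $F:A\,@\,\overline R$ (constants) and $F:A\,@\,\overline R\ \mathsf{where}\ p\sim_R a$ (axioms), with patterns $p::=F\mid p\,x^R\mid p\,x^+\mid p\,\Box^-\mid p\,\bullet$. All judgments are relative to the signature $\Sigma_0$. *Paths and values.* A path is a declared name applied to any number of arguments. $\mathsf{CasePath}_R\,a=F$ holds when $a$ is a path headed by $F$ and either $F$ is a constant, or $F$ is an axiom whose role $R_1$ satisfies $R_1\not\le R$, or $R_1\le R$ and no prefix of $a$ matches the pattern of $F$. $\mathsf{Value}_R$ holds of $\star$, $\Pi$- and $\forall$-types, $\lambda^+x.b$, $\Lambda c.b$, of $\lambda^-x.b$ when $\mathsf{Value}_R\,b$, and of $a$ with $\mathsf{CasePath}_R\,a=F$. $\mathsf{Roles}(F)$ is the declared list; if $\mathsf{Roles}(a)=R,\overline R$ then $\mathsf{Roles}(a\,b^R)=\mathsf{Roles}(a\,b^+)=\overline R$; and $\mathsf{Roles}(a\,\Box^-)=\mathsf{Roles}(a\,\bullet)=\mathsf{Roles}(a)$. $a\leftrightarrow F\,\overline\upsilon$ means that $a$ is $F$ applied to arguments with flags $\overline\upsilon$, where $F$ is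 a constant or an axiom of role $\mathsf{Rep}$. *Reduction.* Primitive reduction $\to^\beta_R$: $(\lambda^\rho x.v)\,b^\rho\to v\{b/x\}$ if $\mathsf{Value}_R(\lambda^\rho x.v)$; $(\Lambda c.b)\,\bullet\to b\{\bullet/c\}$; if $F$ is an axiom $p\sim_{R_1}b$ with $R_1\le R$ and $a$ matches $p$ exactly (same head and flags), then $a\to b$ with the pattern variables replaced by the arguments of $a$; $\mathsf{case}\ a\ \mathsf{of}\ F\,\overline\upsilon\to b_1\|\_\to b_2$ reduces to $b_1'\,\bullet$ if $a\leftrightarrow F\,\overline\upsilon$, where $b_1'$ is $b_1$ applied to the arguments of $a$ (role flags replaced by $+$), and to $b_2$ if $\mathsf{Value}_{\mathsf{Nom}}\,a$ and not $a\leftrightarrow F\,\overline\upsilon$. One-step reduction $\leadsto_R$ contains $\to^\beta_R$ and is closed under $\lambda^-x.[\,]$, $[\,]\,b^\nu$ and $[\,]\,\bullet$ at role $R$; a case steps at any role when its scrutinee steps at $\mathsf{Nom}$. *Typing* $\Gamma\vDash a:A$ (with $\vDash\Gamma$ requiring declared types to have type $\star$ and declared constraints to be well-formed). $\star:\star$;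 variables and declared names have their declared types; $\Pi^\rho x{:}A\to B:\star$ and $\forall c{:}\phi.B:\star$ when their parts are well-formed; $\lambda^\rho x.a:\Pi^\rho x{:}A\to B$ if $\Gamma,x{:}A\vDash a:B$ and, when $\rho=-$, $x$ is not free in $a$; $\Lambda c.a:\forall c{:}\phi.B$ if $\Gamma,c{:}\phi\vDash a:B$. If $b:\Pi^+x{:}A\to B$ and $a:A$, then $b\,a^+:B\{a/x\}$, and $b\,a^R:B\{a/x\}$ if $\mathsf{Roles}(b)=R,\overline R$; if $b:\Pi^-x{:}A\to B$ and $a:A$, then $b\,\Box^-:B\{a/x\}$; if $a_1:\forall c{:}(a\sim_Rb:A).B$ and $\Gamma;\widetilde\Gamma\vDash a\equiv_Rb:A$, then $a_1\,\bullet:B\{\bullet/c\}$. Conversion: $a:A$ and $\Gamma;\widetilde\Gamma\vDash A\equiv_{\mathsf{Rep}}B:\star$ give $a:B$. A case has type $C$ if $a:A$, $b_2:C$, $F$ has a type $\Pi/\forall$-telescope $\overline y\Rightarrow A$ whose binders have the shapes given by $\overline\upsilon$ (with $A$ not depending on $\overline y$), $b_1$ has the type that abstracts over the same telescope and then over $c:(a\sim_{\mathsf{Nom}}F\,\overline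 y:A)$ and returns $C$, and $\overline\upsilon$ is saturated, i.e. its relevant flags correspond one to one to the declared roles $\overline R$ of $F$, each being that role or $+$. A constraint $a\sim_Rb:A$ is well-formed when $a:A$, $b:A$, $A:\star$. *Definitional equality* $\Gamma;\Delta\vDash a\equiv_Rb:A$ and equality of constraints $\Gamma;\Delta\vDash\phi_1\equiv\phi_2$ are generated, between well-typed terms, by: assumptions $c:(a\sim_Rb:A)\in\Gamma$ with $c\in\Delta$; reflexivity, symmetry, transitivity; passage to a larger role; $\to^\beta_R$ between terms of the same type; conversion of the type along $\Gamma;\widetilde\Gamma\vDash A\equiv_{\mathsf{Rep}}B:\star$; congruence for $\Pi,\forall,\lambda,\Lambda$ (bound coercion variables are not added to $\Delta$), for $\bullet$- and $\Box^-$-applications, for $a\,b^+$ (arguments equal at $\mathsf{Nom}$), for $a\,b^{R}$ at role $R'$ (both heads expecting role $R$ next, arguments equal at $R\wedge R'$, both sides of the same type), and for case (scrutinees equal at $\mathsf{Nom}$); injectivity of $\Pi$ (domains; codomains at arguments equal at $\mathsf{Nom}$) and of $\forall$ (constraints; bodies when both constraints hold in $\widetilde\Gamma$); injectivity of $\mathsf{CasePath}_{R_2}$-applications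 with the same head: of the functions at $R_2$ (arguments $b^{R_1}$, $\Box^-$ or $\bullet$), and of the arguments of $a\,b^{R_1}\equiv_{R_2}a'\,b'^{R_1}$ at $R_1\wedge R_2$, when corresponding parts have equal types; equality of the two components, or $\mathsf{Rep}$-equality of the types, gives equal constraints, equal constraints have $\mathsf{Rep}$-equal types, and an equality whose constraint equals another constraint yields the latter. *Signatures.* $\vDash\Sigma_0$ requires distinct names and $\varnothing\vDash A:\star$ for each declared type. For an axiom $F:A\,@\,\overline R\ \mathsf{where}\ p\sim_Ra$, matching the binders of $A$ against the arguments of $p$ (headed by $F$) must give a context $\Gamma$, a result type $B$ and a role context $\Omega$ (the role of $x$ for $x^R$, $\mathsf{Nom}$ for $x^+$, nothing for $\Box^-$) with $\overline R=\mathsf{rng}\,\Omega$, $\Gamma\vDash a:B$ and $\Omega\vDash a:R$. Right-hand sides may use all of $\Sigma_0$. Role-checking $\Omega\vDash a:R$: a variable needs $\Omega(x)\le R$; $\star$, $\Box$ and declared names check at every role; binders enter $\Omega$ at $\mathsf{Nom}$; arguments of $a\,b^\rho$ and scrutinees are checked at $\mathsf{Nom}$, the argument of $a\,b^{R_1}$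 at $R_1\wedge R$, the parts of a constraint $\sim_{R_1}$ at $R_1$, all other parts at $R$. -/

import Mathlib

namespace SystemDR

/-! ## Roles and flags -/

/-- Roles: `nom` (nominal) is the bottom and `rep` (representational) the top. -/
inductive Role where
  | nom
  | rep
  deriving DecidableEq

/-- The order on roles, `R₁ ≤ R₂`. -/
inductive SubRole : Role → Role → Prop
  | nomBot (R : Role) : SubRole .nom R
  | repTop (R : Role) : SubRole R .rep

/-- The minimum `R₁ ∧ R₂` of two roles. -/
def Role.meet : Role → Role → Role
  | .rep, .rep => .rep
  | _, _ => .nom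

/-- Relevance `ρ ::= + | -`. -/
inductive Relevance where
  | rel
  | irr
  deriving DecidableEq

/-- Application flags for terms, `ν ::= R | ρ`. -/
inductive AppFlag where
  | role (R : Role)
  | rho (ρ : Relevance)
  deriving DecidableEq

/-- Application flags, `υ ::= ν | •`. -/
inductive AnyFlag where
  | tm (ν : AppFlag)
  | co
  deriving DecidableEq

/-- Names of constants and axioms. -/
abbrev Const := ℕ

/-! ## Terms

Terms are taken up to renaming of bound variables, by de Bruijn indices. Term variables and
coercion variables are indexed separately. Coercion variables have no occurrences in terms (every
coercion argument is the trivial `•`), so the coercion binders `Λc` and `∀c:φ` bind no index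
inside a term, and `B{•/c}` is `B`. -/

/-- Terms and types. -/
inductive Tm where
  /-- the sort `⋆` -/
  | star
  /-- a term variable -/
  | var (x : ℕ)
  /-- a constant `F` -/
  | fam (F : Const)
  /-- `λ^ρ x. b`; binds one term variable in `b` -/
  | lam (ρ : Relevance) (b : Tm)
  /-- `a b^ν` -/
  | app (a : Tm) (ν : AppFlag) (b : Tm)
  /-- `Π^ρ x:A → B`; binds one term variable in `B` -/
  | pi (ρ : Relevance) (A B : Tm)
  /-- the trivial term `□` that stands for an elided irrelevant argument -/
  | box
  /-- `Λc. b` -/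
  | clam (b : Tm)
  /-- `a •` -/
  | capp (a : Tm)
  /-- `∀c:(a ~_R b : A). B` -/
  | cpi (a b A : Tm) (R : Role) (B : Tm)
  /-- `case a of F υs → b₁ ‖ _ → b₂` -/
  | caseOf (a : Tm) (F : Const) (υs : List AnyFlag) (b₁ b₂ : Tm)

namespace Tm

/-- A renaming under one more term binder. -/
def upRen (ξ : ℕ → ℕ) : ℕ → ℕ
  | 0 => 0
  | n + 1 => ξ n + 1

/-- Renaming of term variables. -/
def rename : (ℕ → ℕ) → Tm → Tm
  | _, star => star
  | ξ, var x => var (ξ x)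
  | _, fam F => fam F
  | ξ, lam ρ b => lam ρ (rename (upRen ξ) b)
  | ξ, app a ν b => app (rename ξ a) ν (rename ξ b)
  | ξ, pi ρ A B => pi ρ (rename ξ A) (rename (upRen ξ) B)
  | _, box => box
  | ξ, clam b => clam (rename ξ b)
  | ξ, capp a => capp (rename ξ a)
  | ξ, cpi a b A R B => cpi (rename ξ a) (rename ξ b) (rename ξ A) R (rename ξ B)
  | ξ, caseOf a F υs b₁ b₂ => caseOf (rename ξ a) F υs (rename ξ b₁) (rename ξ b₂)

/-- Weakening by one term variable. -/
def shift (a : Tm) : Tm := rename Nat.succ a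

/-- A substitution under one more term binder. -/
def upSub (σ : ℕ → Tm) : ℕ → Tm
  | 0 => var 0
  | n + 1 => shift (σ n)

/-- Simultaneous capture-avoiding substitution for term variables. -/
def subst : (ℕ → Tm) → Tm → Tm
  | _, star => star
  | σ, var x => σ x
  | _, fam F => fam F
  | σ, lam ρ b => lam ρ (subst (upSub σ) b)
  | σ, app a ν b => app (subst σ a) ν (subst σ b)
  | σ, pi ρ A B => pi ρ (subst σ A) (subst (upSub σ) B)
  | _, box => box
  | σ, clam b => clam (subst σ b)
  | σ, capp a => capp (subst σ a)
  | σ, cpi a b A R B => cpi (subst σ a) (subst σ b) (subst σ A) R (subst σ B)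
  | σ, caseOf a F υs b₁ b₂ => caseOf (subst σ a) F υs (subst σ b₁) (subst σ b₂)

/-- The substitution that sends the first variables to the listed terms and lowers the others. -/
def env : List Tm → ℕ → Tm
  | [], n => var n
  | t :: _, 0 => t
  | _ :: l, n + 1 => env l n

/-- `B{a/x}`, where `x` is the innermost variable of `B`. -/
def inst (B a : Tm) : Tm := subst (env [a]) B

/-- `FreeIn n a`: the term variable with index `n` occurs free in `a`. -/
def FreeIn : ℕ → Tm → Prop
  | _, star => False
  | n, var x => x = n
  | _, fam _ => False
  | n, lam _ b => FreeIn (n + 1) b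
  | n, app a _ b => FreeIn n a ∨ FreeIn n b
  | n, pi _ A B => FreeIn n A ∨ FreeIn (n + 1) B
  | _, box => False
  | n, clam b => FreeIn n b
  | n, capp a => FreeIn n a
  | n, cpi a b A _ B => FreeIn n a ∨ FreeIn n b ∨ FreeIn n A ∨ FreeIn n B
  | n, caseOf a _ _ b₁ b₂ => FreeIn n a ∨ FreeIn n b₁ ∨ FreeIn n b₂

end Tm

/-- For an irrelevant binder, the bound variable does not occur in the body. -/
def RhoCheck : Relevance → Tm → Prop
  | .rel, _ => True
  | .irr, b => ¬ b.FreeIn 0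

/-- Equality constraints `φ ::= a ~_R b : A`. -/
structure EqProp where
  lhs : Tm
  rhs : Tm
  ty : Tm
  role : Role

/-- Weakening of a constraint by one term variable. -/
def EqProp.shift (φ : EqProp) : EqProp := ⟨φ.lhs.shift, φ.rhs.shift, φ.ty.shift, φ.role⟩

/-- `∀c:φ. B`. -/
abbrev EqProp.all (φ : EqProp) (B : Tm) : Tm := .cpi φ.lhs φ.rhs φ.ty φ.role B

/-! ## Contexts -/

/-- A context entry: `x : A` or `c : φ`. -/
inductive Entry where
  | tm (A : Tm)
  | co (φ : EqProp)

/-- Contexts, with the most recent entry first. -/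
abbrev Context := List Entry

/-- `HasTm Γ x A`: the term variable `x` is declared with type `A` in `Γ`. -/
inductive HasTm : Context → ℕ → Tm → Prop
  | here (Γ : Context) (A : Tm) : HasTm (.tm A :: Γ) 0 A.shift
  | tm (Γ : Context) (x : ℕ) (A B : Tm) : HasTm Γ x A → HasTm (.tm B :: Γ) (x + 1) A.shift
  | co (Γ : Context) (x : ℕ) (A : Tm) (φ : EqProp) : HasTm Γ x A → HasTm (.co φ :: Γ) x A

/-- `HasCo Γ c φ`: the coercion variable `c` is declared with the constraint `φ` in `Γ`. -/
inductive HasCo : Context → ℕ → EqProp → Prop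
  | here (Γ : Context) (φ : EqProp) : HasCo (.co φ :: Γ) 0 φ
  | tm (Γ : Context) (c : ℕ) (φ : EqProp) (A : Tm) :
      HasCo Γ c φ → HasCo (.tm A :: Γ) c φ.shift
  | co (Γ : Context) (c : ℕ) (φ ψ : EqProp) : HasCo Γ c φ → HasCo (.co ψ :: Γ) (c + 1) φ

/-- Sets of available coercion variables. -/
abbrev Avail := Set ℕ

/-- `Γ~`: all coercion variables that `Γ` declares. -/
def avail (Γ : Context) : Avail := {c | ∃ φ, HasCo Γ c φ}

/-- The set `Δ` seen under one more coercion binder, whose variable is not made available. -/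
def Avail.lift (Δ : Avail) : Avail := Nat.succ '' Δ

/-! ## Signatures -/

/-- Patterns `p ::= F | p x^R | p x^+ | p □^- | p •`. The variables of a pattern are nameless.
Each term argument takes one de Bruijn index, the rightmost one being `0`; the index of a `□^-`
argument stands for the elided argument, which may be mentioned only in types. -/
inductive Pat where
  | fam (F : Const)
  | app (p : Pat) (ν : AppFlag)
  | capp (p : Pat)

/-- Declarations of a constant: `A @ Rs`, or `A @ Rs where p ~_R a`. -/
inductive Decl where
  | const (A : Tm) (Rs : List Role)
  | ax (A : Tm) (Rs : List Role) (p : Pat) (R : Role) (a : Tm)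

/-- Signatures. -/
abbrev Sig := List (Const × Decl)

section Judgments

/-! Everything below is relative to a fixed toplevel signature `S`. -/

variable (S : Sig)

/-! ## Paths and values -/

/-- `Head(a) ↦ F`: `a` is an application path headed by the declared constant `F`. -/
inductive ValuePath : Tm → Const → Prop
  | absConst (F : Const) (A : Tm) (Rs : List Role) :
      (F, Decl.const A Rs) ∈ S → ValuePath (.fam F) F
  | const (F : Const) (A : Tm) (Rs : List Role) (p : Pat) (R : Role) (b : Tm) :
      (F, Decl.ax A Rs p R b) ∈ S → ValuePath (.fam F) F
  | app (a : Tm) (ν : AppFlag) (b : Tm) (F : Const) :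
      ValuePath a F → ValuePath (.app a ν b) F
  | capp (a : Tm) (F : Const) : ValuePath a F → ValuePath (.capp a) F

/-- `PatMatch a p σ`: the term `a` unifies with the pattern `p`; `σ` lists the arguments of `a`,
the rightmost first. -/
inductive PatMatch : Tm → Pat → List Tm → Prop
  | fam (F : Const) : PatMatch (.fam F) (.fam F) []
  | app (a : Tm) (p : Pat) (σ : List Tm) (ν : AppFlag) (b : Tm) :
      PatMatch a p σ → PatMatch (.app a ν b) (.app p ν) (b :: σ)
  | capp (a : Tm) (p : Pat) (σ : List Tm) : PatMatch a p σ → PatMatch (.capp a) (.capp p) σ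

/-- Some prefix of the term unifies with the pattern. -/
inductive SubPatMatch : Tm → Pat → Prop
  | base (a : Tm) (p : Pat) (σ : List Tm) : PatMatch a p σ → SubPatMatch a p
  | app (a : Tm) (ν : AppFlag) (b : Tm) (p : Pat) :
      SubPatMatch a p → SubPatMatch (.app a ν b) p
  | capp (a : Tm) (p : Pat) : SubPatMatch a p → SubPatMatch (.capp a) p

/-- `MatchSubst(a, p, b) = b'`. -/
def MatchSubst (a : Tm) (p : Pat) (b b' : Tm) : Prop :=
  ∃ σ, PatMatch a p σ ∧ b' = b.subst (Tm.env σ)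

/-- `CasePath_R a = F`: `a` is a path headed by `F` that cannot reduce at role `R`. -/
inductive CasePath : Role → Tm → Const → Prop
  | absConst (R : Role) (a : Tm) (F : Const) (A : Tm) (Rs : List Role) :
      ValuePath S a F → (F, Decl.const A Rs) ∈ S → CasePath R a F
  | const (R : Role) (a : Tm) (F : Const) (A : Tm) (Rs : List Role) (p : Pat) (R₁ : Role)
      (b : Tm) :
      ValuePath S a F → (F, Decl.ax A Rs p R₁ b) ∈ S → ¬ SubRole R₁ R → CasePath R a F
  | unMatch (R : Role) (a : Tm) (F : Const) (A : Tm) (Rs : List Role) (p : Pat) (R₁ : Role)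
      (b : Tm) :
      ValuePath S a F → (F, Decl.ax A Rs p R₁ b) ∈ S → SubRole R₁ R → ¬ SubPatMatch a p →
      CasePath R a F

/-- `Value_R a`. -/
inductive Value : Role → Tm → Prop
  | star (R : Role) : Value R .star
  | pi (R : Role) (ρ : Relevance) (A B : Tm) : Value R (.pi ρ A B)
  | cpi (R : Role) (φ : EqProp) (B : Tm) : Value R (φ.all B)
  | lamRel (R : Role) (b : Tm) : Value R (.lam .rel b)
  | lamIrr (R : Role) (b : Tm) : Value R b → Value R (.lam .irr b)
  | clam (R : Role) (b : Tm) : Value R (.clam b)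
  | path (R : Role) (a : Tm) (F : Const) : CasePath S R a F → Value R a

/-- `Roles(a) = Rs`: the roles of the parameters that the path `a` still expects. -/
inductive RolePath : Tm → List Role → Prop
  | absConst (F : Const) (A : Tm) (Rs : List Role) :
      (F, Decl.const A Rs) ∈ S → RolePath (.fam F) Rs
  | const (F : Const) (A : Tm) (Rs : List Role) (p : Pat) (R : Role) (b : Tm) :
      (F, Decl.ax A Rs p R b) ∈ S → RolePath (.fam F) Rs
  | tapp (a b : Tm) (R : Role) (Rs : List Role) :
      RolePath a (R :: Rs) → RolePath (.app a (.role R) b) Rs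
  | app (a b : Tm) (R : Role) (Rs : List Role) :
      RolePath a (R :: Rs) → RolePath (.app a (.rho .rel) b) Rs
  | iapp (a : Tm) (Rs : List Role) :
      RolePath a Rs → RolePath (.app a (.rho .irr) .box) Rs
  | capp (a : Tm) (Rs : List Role) : RolePath a Rs → RolePath (.capp a) Rs

/-! ## Reduction -/

/-- `a ↔_R F υs`: `a` is an application, with arguments flagged by `υs`, of a constant `F` that
is not an axiom which unfolds at role `R`. -/
inductive AppsPath : Role → Tm → Const → List AnyFlag → Prop
  | absConst (R : Role) (F : Const) (A : Tm) (Rs : List Role) :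
      (F, Decl.const A Rs) ∈ S → AppsPath R (.fam F) F []
  | const (R : Role) (F : Const) (A : Tm) (Rs : List Role) (p : Pat) (R₁ : Role) (b : Tm) :
      (F, Decl.ax A Rs p R₁ b) ∈ S → ¬ SubRole R₁ R → AppsPath R (.fam F) F []
  | app (R : Role) (a : Tm) (F : Const) (υs : List AnyFlag) (ν : AppFlag) (b : Tm) :
      AppsPath R a F υs → AppsPath R (.app a ν b) F (υs ++ [.tm ν])
  | capp (R : Role) (a : Tm) (F : Const) (υs : List AnyFlag) :
      AppsPath R a F υs → AppsPath R (.capp a) F (υs ++ [.co])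

/-- `ApplyArgs a b b'`: `b'` is `b` applied to the arguments of the path `a`; role annotations
are replaced by `+`. -/
inductive ApplyArgs : Tm → Tm → Tm → Prop
  | const (F : Const) (b : Tm) : ApplyArgs (.fam F) b b
  | appRole (a b b' : Tm) (R : Role) (c : Tm) :
      ApplyArgs a b b' → ApplyArgs (.app a (.role R) c) b (.app b' (.rho .rel) c)
  | appRho (a b b' : Tm) (ρ : Relevance) (c : Tm) :
      ApplyArgs a b b' → ApplyArgs (.app a (.rho ρ) c) b (.app b' (.rho ρ) c)
  | capp (a b b' : Tm) : ApplyArgs a b b' → ApplyArgs (.capp a) b (.capp b')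

/-- The roles of the relevant arguments in a list of flags; the flag `+` may stand for any
role. -/
inductive AppRoles : List AnyFlag → List Role → Prop
  | nil : AppRoles [] []
  | tapp (υs : List AnyFlag) (R : Role) (Rs : List Role) :
      AppRoles υs Rs → AppRoles (.tm (.role R) :: υs) (R :: Rs)
  | app (υs : List AnyFlag) (R : Role) (Rs : List Role) :
      AppRoles υs Rs → AppRoles (.tm (.rho .rel) :: υs) (R :: Rs)
  | iapp (υs : List AnyFlag) (Rs : List Role) :
      AppRoles υs Rs → AppRoles (.tm (.rho .irr) :: υs) Rs
  | capp (υs : List AnyFlag) (Rs : List Role) : AppRoles υs Rs → AppRoles (.co :: υs) Rs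

/-- `F υs` is saturated with respect to the role-annotated parameters of `F`. -/
inductive SatApp : Const → List AnyFlag → Prop
  | const (F : Const) (A : Tm) (Rs : List Role) (υs : List AnyFlag) :
      (F, Decl.const A Rs) ∈ S → AppRoles υs Rs → SatApp F υs
  | ax (F : Const) (A : Tm) (Rs : List Role) (p : Pat) (R : Role) (b : Tm)
      (υs : List AnyFlag) :
      (F, Decl.ax A Rs p R b) ∈ S → AppRoles υs Rs → SatApp F υs

/-- Primitive reduction, `⊨ a →^β_R b`. -/
inductive Beta : Role → Tm → Tm → Prop
  | appAbs (R : Role) (ρ : Relevance) (v b : Tm) :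
      Value S R (.lam ρ v) → Beta R (.app (.lam ρ v) (.rho ρ) b) (v.inst b)
  | cappCAbs (R : Role) (b : Tm) : Beta R (.capp (.clam b)) b
  | axiomStep (R : Role) (F : Const) (A : Tm) (Rs : List Role) (p : Pat) (R₁ : Role)
      (a b b' : Tm) :
      (F, Decl.ax A Rs p R₁ b) ∈ S → MatchSubst a p b b' → SubRole R₁ R → Beta R a b'
  | patternTrue (R : Role) (a : Tm) (F : Const) (υs : List AnyFlag) (b₁ b₂ b₁' : Tm) :
      AppsPath S .nom a F υs → ApplyArgs a b₁ b₁' →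
      Beta R (.caseOf a F υs b₁ b₂) (.capp b₁')
  | patternFalse (R : Role) (a : Tm) (F : Const) (υs : List AnyFlag) (b₁ b₂ : Tm) :
      Value S .nom a → ¬ AppsPath S .nom a F υs →
      Beta R (.caseOf a F υs b₁ b₂) b₂

/-- One-step reduction, `⊨ a ⇝_R a'`. -/
inductive Step : Role → Tm → Tm → Prop
  | absTerm (R : Role) (a a' : Tm) : Step R a a' → Step R (.lam .irr a) (.lam .irr a')
  | appLeft (R : Role) (a a' : Tm) (ν : AppFlag) (b : Tm) :
      Step R a a' → Step R (.app a ν b) (.app a' ν b)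
  | cappLeft (R : Role) (a a' : Tm) : Step R a a' → Step R (.capp a) (.capp a')
  | pattern (R : Role) (a a' : Tm) (F : Const) (υs : List AnyFlag) (b₁ b₂ : Tm) :
      Step .nom a a' → Step R (.caseOf a F υs b₁ b₂) (.caseOf a' F υs b₁ b₂)
  | prim (R : Role) (a b : Tm) : Beta S R a b → Step R a b

/-! ## Typing and definitional equality -/

/-- `BranchTyping υs R a A w A₁ B C`: if `w` is the part of the pattern `F υs` applied so far to
pattern variables, `A₁` is its type and `υs` are the remaining flags, then `B` is the type of a
branch that takes the remaining arguments and a proof that the scrutinee `a : A` equals the full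
pattern at role `R`, and returns a `C`. -/
inductive BranchTyping : List AnyFlag → Role → Tm → Tm → Tm → Tm → Tm → Tm → Prop
  | base (R : Role) (a A w C : Tm) :
      BranchTyping [] R a A w A (.cpi a w A R C) C
  | piRole (υs : List AnyFlag) (R R' : Role) (a A₁ w A B C C' : Tm) :
      BranchTyping υs R a.shift A₁.shift (.app w.shift (.role R') (.var 0)) B C C'.shift →
      BranchTyping (.tm (.role R') :: υs) R a A₁ w (.pi .rel A B) (.pi .rel A C) C'
  | piRel (υs : List AnyFlag) (R : Role) (a A₁ w A B C C' : Tm) :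
      BranchTyping υs R a.shift A₁.shift (.app w.shift (.rho .rel) (.var 0)) B C C'.shift →
      BranchTyping (.tm (.rho .rel) :: υs) R a A₁ w (.pi .rel A B) (.pi .rel A C) C'
  | piIrrel (υs : List AnyFlag) (R : Role) (a A₁ w A B C C' : Tm) :
      BranchTyping υs R a.shift A₁.shift (.app w.shift (.rho .irr) .box) B C C'.shift →
      BranchTyping (.tm (.rho .irr) :: υs) R a A₁ w (.pi .irr A B) (.pi .irr A C) C'
  | cPi (υs : List AnyFlag) (R : Role) (a A₁ w : Tm) (φ : EqProp) (B C C' : Tm) :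
      BranchTyping υs R a A₁ (.capp w) B C C' →
      BranchTyping (.co :: υs) R a A₁ w (φ.all B) (φ.all C) C'

mutual

/-- Typing, `Γ ⊨ a : A`. -/
inductive Typing : Context → Tm → Tm → Prop
  | star (Γ : Context) : CtxOk Γ → Typing Γ .star .star
  | var (Γ : Context) (x : ℕ) (A : Tm) : CtxOk Γ → HasTm Γ x A → Typing Γ (.var x) A
  | pi (Γ : Context) (ρ : Relevance) (A B : Tm) :
      Typing (.tm A :: Γ) B .star → Typing Γ A .star → Typing Γ (.pi ρ A B) .star
  | abs (Γ : Context) (ρ : Relevance) (a A B : Tm) :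
      Typing (.tm A :: Γ) a B → Typing Γ A .star → RhoCheck ρ a →
      Typing Γ (.lam ρ a) (.pi ρ A B)
  | app (Γ : Context) (a b A B : Tm) :
      Typing Γ b (.pi .rel A B) → Typing Γ a A →
      Typing Γ (.app b (.rho .rel) a) (B.inst a)
  | tapp (Γ : Context) (a b A B : Tm) (R : Role) (Rs : List Role) :
      Typing Γ b (.pi .rel A B) → Typing Γ a A → RolePath S b (R :: Rs) →
      Typing Γ (.app b (.role R) a) (B.inst a)
  | iapp (Γ : Context) (a b A B : Tm) :
      Typing Γ b (.pi .irr A B) → Typing Γ a A →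
      Typing Γ (.app b (.rho .irr) .box) (B.inst a)
  | conv (Γ : Context) (a A B : Tm) :
      Typing Γ a A → DefEq Γ (avail Γ) A B .star .rep → Typing Γ B .star → Typing Γ a B
  | cpi (Γ : Context) (φ : EqProp) (B : Tm) :
      Typing (.co φ :: Γ) B .star → PropOk Γ φ → Typing Γ (φ.all B) .star
  | cabs (Γ : Context) (φ : EqProp) (a B : Tm) :
      Typing (.co φ :: Γ) a B → PropOk Γ φ → Typing Γ (.clam a) (φ.all B)
  | capp (Γ : Context) (a₁ a b A : Tm) (R : Role) (B : Tm) :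
      Typing Γ a₁ (.cpi a b A R B) → DefEq Γ (avail Γ) a b A R → Typing Γ (.capp a₁) B
  | const (Γ : Context) (F : Const) (A : Tm) (Rs : List Role) :
      CtxOk Γ → (F, Decl.const A Rs) ∈ S → Typing [] A .star → Typing Γ (.fam F) A
  | fam (Γ : Context) (F : Const) (A : Tm) (Rs : List Role) (p : Pat) (R : Role) (b : Tm) :
      CtxOk Γ → (F, Decl.ax A Rs p R b) ∈ S → Typing [] A .star → Typing Γ (.fam F) A
  | caseOf (Γ : Context) (a : Tm) (F : Const) (υs : List AnyFlag) (b₁ b₂ A A₁ B C : Tm) :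
      Typing Γ a A → Typing Γ (.fam F) A₁ → Typing Γ b₁ B → Typing Γ b₂ C →
      BranchTyping υs .nom a A (.fam F) A₁ B C → SatApp S F υs →
      Typing Γ (.caseOf a F υs b₁ b₂) C

/-- Well-formed constraints, `Γ ⊨ φ ok`. -/
inductive PropOk : Context → EqProp → Prop
  | wff (Γ : Context) (a b A : Tm) (R : Role) :
      Typing Γ a A → Typing Γ b A → Typing Γ A .star → PropOk Γ ⟨a, b, A, R⟩

/-- Definitional equality of constraints, `Γ; Δ ⊨ φ₁ ≡ φ₂`. -/
inductive Iso : Context → Avail → EqProp → EqProp → Prop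
  | propCong (Γ : Context) (Δ : Avail) (a₁ a₂ b₁ b₂ A : Tm) (R : Role) :
      DefEq Γ Δ a₁ a₂ A R → DefEq Γ Δ b₁ b₂ A R → Iso Γ Δ ⟨a₁, b₁, A, R⟩ ⟨a₂, b₂, A, R⟩
  | isoConv (Γ : Context) (Δ : Avail) (a b A B : Tm) (R : Role) :
      DefEq Γ Δ A B .star .rep → PropOk Γ ⟨a, b, A, R⟩ → PropOk Γ ⟨a, b, B, R⟩ →
      Iso Γ Δ ⟨a, b, A, R⟩ ⟨a, b, B, R⟩
  | cpiFst (Γ : Context) (Δ : Avail) (φ₁ φ₂ : EqProp) (B₁ B₂ : Tm) (R' : Role) :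
      DefEq Γ Δ (φ₁.all B₁) (φ₂.all B₂) .star R' → Iso Γ Δ φ₁ φ₂

/-- Definitional equality, `Γ; Δ ⊨ a ≡_R b : A`, written `DefEq Γ Δ a b A R`. -/
inductive DefEq : Context → Avail → Tm → Tm → Tm → Role → Prop
  | assn (Γ : Context) (Δ : Avail) (c : ℕ) (a b A : Tm) (R : Role) :
      CtxOk Γ → HasCo Γ c ⟨a, b, A, R⟩ → c ∈ Δ → DefEq Γ Δ a b A R
  | refl (Γ : Context) (Δ : Avail) (a A : Tm) (R : Role) :
      Typing Γ a A → DefEq Γ Δ a a A R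
  | symm (Γ : Context) (Δ : Avail) (a b A : Tm) (R : Role) :
      DefEq Γ Δ b a A R → DefEq Γ Δ a b A R
  | trans (Γ : Context) (Δ : Avail) (a a₁ b A : Tm) (R : Role) :
      DefEq Γ Δ a a₁ A R → DefEq Γ Δ a₁ b A R → DefEq Γ Δ a b A R
  | sub (Γ : Context) (Δ : Avail) (a b A : Tm) (R₁ R₂ : Role) :
      DefEq Γ Δ a b A R₁ → SubRole R₁ R₂ → DefEq Γ Δ a b A R₂
  | beta (Γ : Context) (Δ : Avail) (a₁ a₂ B : Tm) (R : Role) :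
      Typing Γ a₁ B → Typing Γ a₂ B → Beta S R a₁ a₂ → DefEq Γ Δ a₁ a₂ B R
  | piCong (Γ : Context) (Δ : Avail) (ρ : Relevance) (A₁ B₁ A₂ B₂ : Tm) (R : Role) :
      DefEq Γ Δ A₁ A₂ .star R → DefEq (.tm A₁ :: Γ) Δ B₁ B₂ .star R →
      Typing Γ A₁ .star → Typing Γ (.pi ρ A₁ B₁) .star → Typing Γ (.pi ρ A₂ B₂) .star →
      DefEq Γ Δ (.pi ρ A₁ B₁) (.pi ρ A₂ B₂) .star R
  | absCong (Γ : Context) (Δ : Avail) (ρ : Relevance) (b₁ b₂ A₁ B : Tm) (R : Role) :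
      DefEq (.tm A₁ :: Γ) Δ b₁ b₂ B R → Typing Γ A₁ .star →
      RhoCheck ρ b₁ → RhoCheck ρ b₂ →
      DefEq Γ Δ (.lam ρ b₁) (.lam ρ b₂) (.pi ρ A₁ B) R
  | appCong (Γ : Context) (Δ : Avail) (a₁ a₂ b₁ b₂ A B : Tm) (R : Role) :
      DefEq Γ Δ a₁ b₁ (.pi .rel A B) R → DefEq Γ Δ a₂ b₂ A .nom →
      DefEq Γ Δ (.app a₁ (.rho .rel) a₂) (.app b₁ (.rho .rel) b₂) (B.inst a₂) R
  | tappCong (Γ : Context) (Δ : Avail) (a₁ a₂ b₁ b₂ A B : Tm) (R R' : Role)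
      (Rs Rs' : List Role) :
      DefEq Γ Δ a₁ b₁ (.pi .rel A B) R' → DefEq Γ Δ a₂ b₂ A (R.meet R') →
      RolePath S a₁ (R :: Rs) → RolePath S b₁ (R :: Rs') →
      Typing Γ (.app b₁ (.role R) b₂) (B.inst a₂) →
      DefEq Γ Δ (.app a₁ (.role R) a₂) (.app b₁ (.role R) b₂) (B.inst a₂) R'
  | iappCong (Γ : Context) (Δ : Avail) (a₁ b₁ a A B : Tm) (R : Role) :
      DefEq Γ Δ a₁ b₁ (.pi .irr A B) R → Typing Γ a A →
      DefEq Γ Δ (.app a₁ (.rho .irr) .box) (.app b₁ (.rho .irr) .box) (B.inst a) R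
  | piFst (Γ : Context) (Δ : Avail) (ρ : Relevance) (A₁ B₁ A₂ B₂ : Tm) (R : Role) :
      DefEq Γ Δ (.pi ρ A₁ B₁) (.pi ρ A₂ B₂) .star R → DefEq Γ Δ A₁ A₂ .star R
  | piSnd (Γ : Context) (Δ : Avail) (ρ : Relevance) (A₁ B₁ A₂ B₂ a₁ a₂ : Tm) (R : Role) :
      DefEq Γ Δ (.pi ρ A₁ B₁) (.pi ρ A₂ B₂) .star R → DefEq Γ Δ a₁ a₂ A₁ .nom →
      DefEq Γ Δ (B₁.inst a₁) (B₂.inst a₂) .star R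
  | cpiCong (Γ : Context) (Δ : Avail) (φ₁ φ₂ : EqProp) (B₁ B₂ : Tm) (R : Role) :
      Iso Γ Δ φ₁ φ₂ → DefEq (.co φ₁ :: Γ) Δ.lift B₁ B₂ .star R → PropOk Γ φ₁ →
      Typing Γ (φ₁.all B₁) .star → Typing Γ (φ₂.all B₂) .star →
      DefEq Γ Δ (φ₁.all B₁) (φ₂.all B₂) .star R
  | cabsCong (Γ : Context) (Δ : Avail) (φ : EqProp) (a b B : Tm) (R : Role) :
      DefEq (.co φ :: Γ) Δ.lift a b B R → PropOk Γ φ →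
      DefEq Γ Δ (.clam a) (.clam b) (φ.all B) R
  | cappCong (Γ : Context) (Δ : Avail) (a₁ b₁ a b A : Tm) (R : Role) (B : Tm) (R' : Role) :
      DefEq Γ Δ a₁ b₁ (.cpi a b A R B) R' → DefEq Γ (avail Γ) a b A R →
      DefEq Γ Δ (.capp a₁) (.capp b₁) B R'
  | cpiSnd (Γ : Context) (Δ : Avail) (a₁ a₂ A : Tm) (R : Role) (B : Tm) (a₁' a₂' A' : Tm)
      (R' : Role) (B' : Tm) (R₀ : Role) :
      DefEq Γ Δ (.cpi a₁ a₂ A R B) (.cpi a₁' a₂' A' R' B') .star R₀ →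
      DefEq Γ (avail Γ) a₁ a₂ A R → DefEq Γ (avail Γ) a₁' a₂' A' R' →
      DefEq Γ Δ B B' .star R₀
  | cast (Γ : Context) (Δ : Avail) (a b A : Tm) (R : Role) (a' b' A' : Tm) (R' : Role) :
      DefEq Γ Δ a b A R → Iso Γ Δ ⟨a, b, A, R⟩ ⟨a', b', A', R'⟩ → DefEq Γ Δ a' b' A' R'
  | eqConv (Γ : Context) (Δ : Avail) (a b A B : Tm) (R : Role) :
      DefEq Γ Δ a b A R → DefEq Γ (avail Γ) A B .star .rep → Typing Γ B .star →
      DefEq Γ Δ a b B R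
  | isoSnd (Γ : Context) (Δ : Avail) (a b A : Tm) (R : Role) (a' b' A' : Tm) (R' : Role) :
      Iso Γ Δ ⟨a, b, A, R⟩ ⟨a', b', A', R'⟩ → DefEq Γ Δ A A' .star .rep
  | patCong (Γ : Context) (Δ : Avail) (F : Const) (υs : List AnyFlag)
      (a a' b₁ b₁' b₂ b₂' A A₁ B B' C : Tm) (R : Role) :
      DefEq Γ Δ a a' A .nom → DefEq Γ Δ b₁ b₁' B R → DefEq Γ Δ b₂ b₂' C R →
      Typing Γ a A → Typing Γ a' A → Typing Γ (.fam F) A₁ →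
      BranchTyping υs .nom a A (.fam F) A₁ B C →
      BranchTyping υs .nom a' A (.fam F) A₁ B' C →
      Typing Γ b₁ B → Typing Γ b₁' B' → DefEq Γ (avail Γ) B B' .star .rep →
      SatApp S F υs →
      DefEq Γ Δ (.caseOf a F υs b₁ b₂) (.caseOf a' F υs b₁' b₂') C R
  | leftRel (Γ : Context) (Δ : Avail) (F : Const) (a b a' b' A B : Tm) (R₁ R₂ : Role) :
      CasePath S R₂ (.app a (.role R₁) b) F → CasePath S R₂ (.app a' (.role R₁) b') F →
      Typing Γ a (.pi .rel A B) → Typing Γ b A →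
      Typing Γ a' (.pi .rel A B) → Typing Γ b' A →
      DefEq Γ Δ (.app a (.role R₁) b) (.app a' (.role R₁) b') (B.inst b) R₂ →
      DefEq Γ (avail Γ) (B.inst b) (B.inst b') .star .rep →
      DefEq Γ Δ a a' (.pi .rel A B) R₂
  | leftIrrel (Γ : Context) (Δ : Avail) (F : Const) (a b a' b' A B : Tm) (R₂ : Role) :
      CasePath S R₂ (.app a (.rho .irr) .box) F →
      CasePath S R₂ (.app a' (.rho .irr) .box) F →
      Typing Γ a (.pi .irr A B) → Typing Γ b A →
      Typing Γ a' (.pi .irr A B) → Typing Γ b' A →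
      DefEq Γ Δ (.app a (.rho .irr) .box) (.app a' (.rho .irr) .box) (B.inst b) R₂ →
      DefEq Γ (avail Γ) (B.inst b) (B.inst b') .star .rep →
      DefEq Γ Δ a a' (.pi .irr A B) R₂
  | right (Γ : Context) (Δ : Avail) (F : Const) (a b a' b' A B : Tm) (R₁ R₂ : Role) :
      CasePath S R₂ (.app a (.role R₁) b) F → CasePath S R₂ (.app a' (.role R₁) b') F →
      Typing Γ a (.pi .rel A B) → Typing Γ b A →
      Typing Γ a' (.pi .rel A B) → Typing Γ b' A →
      DefEq Γ Δ (.app a (.role R₁) b) (.app a' (.role R₁) b') (B.inst b) R₂ →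
      DefEq Γ (avail Γ) (B.inst b) (B.inst b') .star .rep →
      DefEq Γ Δ b b' A (R₁.meet R₂)
  | cLeft (Γ : Context) (Δ : Avail) (F : Const) (a a' a₁ a₂ A : Tm) (R₁ : Role) (B : Tm)
      (R₂ : Role) :
      CasePath S R₂ (.capp a) F → CasePath S R₂ (.capp a') F →
      Typing Γ a (.cpi a₁ a₂ A R₁ B) → Typing Γ a' (.cpi a₁ a₂ A R₁ B) →
      DefEq Γ (avail Γ) a₁ a₂ A R₁ →
      DefEq Γ Δ (.capp a) (.capp a') B R₂ →
      DefEq Γ Δ a a' (.cpi a₁ a₂ A R₁ B) R₂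

/-- Well-formed contexts, `⊨ Γ`. -/
inductive CtxOk : Context → Prop
  | empty : CtxOk []
  | consTm (Γ : Context) (A : Tm) : CtxOk Γ → Typing Γ A .star → CtxOk (.tm A :: Γ)
  | consCo (Γ : Context) (φ : EqProp) : CtxOk Γ → PropOk Γ φ → CtxOk (.co φ :: Γ)

end

/-! ## Role-checking and well-formed signatures -/

/-- Role-checking contexts `Ω`, indexed by term variables; `none` marks a variable to which `Ω`
assigns no role (and which therefore may not be used). -/
abbrev RoleCtx := List (Option Role)

/-- Role-checking, `Ω ⊨ a : R`. -/
inductive Roleing : RoleCtx → Tm → Role → Prop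
  | box (Ω : RoleCtx) (R : Role) : Roleing Ω .box R
  | star (Ω : RoleCtx) (R : Role) : Roleing Ω .star R
  | var (Ω : RoleCtx) (x : ℕ) (R R₁ : Role) :
      Ω.getD x none = some R → SubRole R R₁ → Roleing Ω (.var x) R₁
  | const (Ω : RoleCtx) (F : Const) (A : Tm) (Rs : List Role) (R : Role) :
      (F, Decl.const A Rs) ∈ S → Roleing Ω (.fam F) R
  | fam (Ω : RoleCtx) (F : Const) (A : Tm) (Rs : List Role) (p : Pat) (R₁ : Role) (b : Tm)
      (R : Role) :
      (F, Decl.ax A Rs p R₁ b) ∈ S → Roleing Ω (.fam F) R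
  | abs (Ω : RoleCtx) (ρ : Relevance) (b : Tm) (R : Role) :
      Roleing (some .nom :: Ω) b R → Roleing Ω (.lam ρ b) R
  | app (Ω : RoleCtx) (a : Tm) (ρ : Relevance) (b : Tm) (R : Role) :
      Roleing Ω a R → Roleing Ω b .nom → Roleing Ω (.app a (.rho ρ) b) R
  | tapp (Ω : RoleCtx) (a : Tm) (R₁ : Role) (b : Tm) (R : Role) :
      Roleing Ω a R → Roleing Ω b (R₁.meet R) → Roleing Ω (.app a (.role R₁) b) R
  | pi (Ω : RoleCtx) (ρ : Relevance) (A B : Tm) (R : Role) :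
      Roleing Ω A R → Roleing (some .nom :: Ω) B R → Roleing Ω (.pi ρ A B) R
  | cabs (Ω : RoleCtx) (b : Tm) (R : Role) : Roleing Ω b R → Roleing Ω (.clam b) R
  | capp (Ω : RoleCtx) (a : Tm) (R : Role) : Roleing Ω a R → Roleing Ω (.capp a) R
  | cpi (Ω : RoleCtx) (a b A : Tm) (R₁ : Role) (B : Tm) (R : Role) :
      Roleing Ω a R₁ → Roleing Ω b R₁ → Roleing Ω A R₁ → Roleing Ω B R →
      Roleing Ω (.cpi a b A R₁ B) R
  | caseOf (Ω : RoleCtx) (a : Tm) (F : Const) (υs : List AnyFlag) (b₁ b₂ : Tm) (R : Role) :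
      Roleing Ω a .nom → Roleing Ω b₁ R → Roleing Ω b₂ R →
      Roleing Ω (.caseOf a F υs b₁ b₂) R

/-- `PatCtx(p, F : A) = Γ; B; Ω`: the context of the variables of the pattern `p`, the type of
the pattern in that context, and the roles of its relevant variables. -/
inductive PatCtx (F : Const) (A : Tm) : Pat → Context → Tm → RoleCtx → Prop
  | const : PatCtx F A (.fam F) [] A []
  | piRole (p : Pat) (Γ : Context) (A' B : Tm) (Ω : RoleCtx) (R : Role) :
      PatCtx F A p Γ (.pi .rel A' B) Ω →
      PatCtx F A (.app p (.role R)) (.tm A' :: Γ) B (some R :: Ω)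
  | piRel (p : Pat) (Γ : Context) (A' B : Tm) (Ω : RoleCtx) :
      PatCtx F A p Γ (.pi .rel A' B) Ω →
      PatCtx F A (.app p (.rho .rel)) (.tm A' :: Γ) B (some .nom :: Ω)
  | piIrr (p : Pat) (Γ : Context) (A' B : Tm) (Ω : RoleCtx) :
      PatCtx F A p Γ (.pi .irr A' B) Ω →
      PatCtx F A (.app p (.rho .irr)) (.tm A' :: Γ) B (none :: Ω)
  | cpi (p : Pat) (Γ : Context) (φ : EqProp) (B : Tm) (Ω : RoleCtx) :
      PatCtx F A p Γ (φ.all B) Ω → PatCtx F A (.capp p) (.co φ :: Γ) B Ω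

/-- `rng Ω`: the roles in `Ω`, in the order of the pattern (the oldest first). -/
def RoleCtx.rng (Ω : RoleCtx) : List Role := Ω.reduceOption.reverse

/-- The declarations in the given list are well-formed, where types and right-hand sides may use
every name of the whole signature `S`. -/
inductive SigWf : Sig → Prop
  | empty : SigWf []
  | consConst (T : Sig) (F : Const) (A : Tm) (Rs : List Role) :
      SigWf T → Typing S [] A .star → (∀ d, (F, d) ∉ T) →
      SigWf ((F, .const A Rs) :: T)
  | consAx (T : Sig) (F : Const) (A : Tm) (p : Pat) (R : Role) (a : Tm) (Γ : Context)
      (B : Tm) (Ω : RoleCtx) :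
      SigWf T → (∀ d, (F, d) ∉ T) → Typing S [] A .star → PatCtx F A p Γ B Ω →
      Typing S Γ a B → Roleing S Ω a R →
      SigWf ((F, .ax A Ω.rng p R a) :: T)

/-- The toplevel signature is well-formed, `⊨ Σ₀`. -/
def SigOk : Prop := SigWf S S

end Judgments

end SystemDR

/-!
Preservation is proved by induction on the reduction step. A primitive step is a rule of
definitional equality, so only its reduct has to be typed; every other step is an instance of a
congruence rule. The point of the argument is that it needs no consistency of definitional
equality, hence no assumption on the context. When a redex such as `(λ x. v) b` is typed, its parts
are typed up to conversion: `v` by some `Π A' → B'`, the argument by the domain of another `Π A → B`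
that is definitionally equal to it. Usually one would compare the two by confluence; here
injectivity of `Π` and `∀` consists of rules of definitional equality itself (`Typing.pi_conv`,
`EqProp.Holds.cpi_conv`), so equal types always have equal components, even in a context with
contradictory assumptions.

What remains is the metatheory that makes this work. Typing and equality are closed under renamings
and under well-typed substitutions. Both are instances of one induction over the mutually defined
judgments (`Typing.map`, `DefEq.map`), for a class of substitutions that can be moved below binders;
weakening is the first instance, and the second one uses it. Generation (`Typing.generation`) and
regularity of typing (`Typing.typing_star`) follow. Regularity of definitional equality is never
needed, because its rules carry the typing premises that the argument uses.

Three cases deserve mention.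

* Unfolding an axiom. The arguments of a path that matches a pattern give a well-typed substitution
  for the pattern context (`PatMatch.exists_isSubst`), except that for an irrelevant argument `□`
  the substitution must take the elided term. The right-hand side does not see the difference,
  since role-checking assigns no role to such a variable (`Roleing.getD_of_freeIn`).
* A case whose scrutinee is a path of the right shape. The type of the branch is instantiated
  argument by argument along the path (`AppsPath.branchTyping`); its last premise has become the
  equation of the scrutinee with itself. When the scrutinee only steps, the type of the branch
  changes to an equal one (`BranchTyping.exists_defEq`).
* A step of the function in `a b^R`. The congruence rule would need the reduct of `a` to be a path
  again, but the case does not arise: typing demands that the path `a` still expects a parameter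
  with a role, and then it has too few arguments for its head to unfold (`Step.not_rolePath`).
-/

namespace SystemDR

variable {S : Sig}

/-! ### Substitution algebra -/

namespace Tm

theorem rename_eq_subst (a : Tm) : ∀ ξ : ℕ → ℕ, a.rename ξ = a.subst fun x => var (ξ x) := by
  have up (ξ : ℕ → ℕ) : (fun x => var (upRen ξ x)) = upSub fun x => var (ξ x) := by
    funext x; cases x <;> rfl
  induction a <;> intro ξ <;> simp_all [rename, subst]

theorem subst_congr {a : Tm} : ∀ {σ τ : ℕ → Tm}, (∀ x, FreeIn x a → σ x = τ x) →
    a.subst σ = a.subst τ := by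
  have up {b : Tm} {σ τ : ℕ → Tm} (h : ∀ x, FreeIn (x + 1) b → σ x = τ x) (x : ℕ)
      (hx : FreeIn x b) : upSub σ x = upSub τ x := by
    cases x with
    | zero => rfl
    | succ x => exact congrArg shift (h x hx)
  induction a with
  | var x => intro σ τ h; exact h x rfl
  | lam ρ b ih => intro σ τ h; simp only [subst]; rw [ih (up h)]
  | app a ν b iha ihb =>
    intro σ τ h; simp only [subst]
    rw [iha fun x hx => h x (.inl hx), ihb fun x hx => h x (.inr hx)]
  | pi ρ A B ihA ihB =>
    intro σ τ h; simp only [subst]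
    rw [ihA fun x hx => h x (.inl hx), ihB (up fun x hx => h x (.inr hx))]
  | clam b ih => intro σ τ h; simp only [subst]; rw [ih h]
  | capp b ih => intro σ τ h; simp only [subst]; rw [ih h]
  | cpi a b A R B iha ihb ihA ihB =>
    intro σ τ h; simp only [subst]
    rw [iha fun x hx => h x (.inl hx), ihb fun x hx => h x (.inr (.inl hx)),
      ihA fun x hx => h x (.inr (.inr (.inl hx))), ihB fun x hx => h x (.inr (.inr (.inr hx)))]
  | caseOf a F υs b₁ b₂ iha ih₁ ih₂ =>
    intro σ τ h; simp only [subst]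
    rw [iha fun x hx => h x (.inl hx), ih₁ fun x hx => h x (.inr (.inl hx)),
      ih₂ fun x hx => h x (.inr (.inr hx))]
  | _ => intros; rfl

@[simp] theorem subst_var (a : Tm) : a.subst var = a := by
  have up : upSub var = var := by funext x; cases x <;> rfl
  induction a <;> simp_all [subst]

theorem subst_rename (a : Tm) : ∀ (ξ : ℕ → ℕ) (σ : ℕ → Tm),
    (a.rename ξ).subst σ = a.subst fun x => σ (ξ x) := by
  have up (ξ : ℕ → ℕ) (σ : ℕ → Tm) :
      (fun x => upSub σ (upRen ξ x)) = upSub fun x => σ (ξ x) := by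
    funext x; cases x <;> rfl
  induction a <;> intro ξ σ <;> simp_all [rename, subst]

theorem rename_subst (a : Tm) : ∀ (ξ : ℕ → ℕ) (σ : ℕ → Tm),
    (a.subst σ).rename ξ = a.subst fun x => (σ x).rename ξ := by
  have up (ξ : ℕ → ℕ) (σ : ℕ → Tm) :
      (fun x => (upSub σ x).rename (upRen ξ)) = upSub fun x => (σ x).rename ξ := by
    funext x
    cases x with
    | zero => rfl
    | succ x =>
      simp only [upSub, shift]
      rw [rename_eq_subst (rename _ _), rename_eq_subst (rename _ _), subst_rename, subst_rename]
      rfl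
  induction a <;> intro ξ σ <;> simp_all [rename, subst]

theorem subst_subst (a : Tm) : ∀ σ τ : ℕ → Tm,
    (a.subst σ).subst τ = a.subst fun x => (σ x).subst τ := by
  have up (σ τ : ℕ → Tm) :
      (fun x => (upSub σ x).subst (upSub τ)) = upSub fun x => (σ x).subst τ := by
    funext x
    cases x with
    | zero => rfl
    | succ x => simp only [upSub, shift, subst_rename, rename_subst]
  induction a <;> intro σ τ <;> simp_all [subst]

theorem shift_eq_subst (a : Tm) : a.shift = a.subst fun x => var (x + 1) := rename_eq_subst a _

@[simp] theorem shift_subst_upSub (a : Tm) (σ : ℕ → Tm) :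
    a.shift.subst (upSub σ) = (a.subst σ).shift := by
  simp only [shift, subst_rename, rename_subst]; rfl

@[simp] theorem shift_inst (a b : Tm) : a.shift.inst b = a := by
  simp only [shift, inst, subst_rename]; exact subst_var a

theorem shift_subst_env (a b : Tm) (l : List Tm) :
    a.shift.subst (env (b :: l)) = a.subst (env l) := by
  simp only [shift, subst_rename]; rfl

theorem subst_upSub_inst (B a : Tm) (σ : ℕ → Tm) :
    (B.subst (upSub σ)).inst a = B.subst fun | 0 => a | x + 1 => σ x := by
  simp only [inst, subst_subst]
  congr 1; funext x
  cases x with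
  | zero => rfl
  | succ x => exact shift_inst (σ x) a

theorem inst_subst (B a : Tm) (σ : ℕ → Tm) :
    (B.inst a).subst σ = (B.subst (upSub σ)).inst (a.subst σ) := by
  rw [subst_upSub_inst, inst, subst_subst]
  congr 1; funext x; cases x <;> rfl

theorem subst_env_upSub_inst (B a : Tm) (l : List Tm) :
    (B.subst (upSub (env l))).inst a = B.subst (env (a :: l)) := by
  rw [subst_upSub_inst]
  congr 1; funext x; cases x <;> rfl

theorem exists_freeIn_of_freeIn_rename {a : Tm} : ∀ {n : ℕ} {ξ : ℕ → ℕ},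
    FreeIn n (a.rename ξ) → ∃ m, FreeIn m a ∧ ξ m = n := by
  have up {b : Tm} {n : ℕ} {ξ : ℕ → ℕ} : (∃ m, FreeIn m b ∧ upRen ξ m = n + 1) →
      ∃ m, FreeIn (m + 1) b ∧ ξ m = n := by
    rintro ⟨_ | m, h, e⟩
    · cases e
    · exact ⟨m, h, Nat.succ.inj e⟩
  induction a with
  | lam ρ b ih => intro n ξ h; exact up (ih h)
  | pi ρ A B ihA ihB =>
    rintro n ξ (h | h)
    · exact (ihA h).imp fun _ h => h.imp .inl id
    · exact (up (ihB h)).imp fun _ h => h.imp .inr id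
  | _ => intro n ξ h; simp only [rename, FreeIn] at h ⊢ <;> grind

theorem freeIn_of_freeIn_shift {a : Tm} {n : ℕ} (h : FreeIn (n + 1) a.shift) : FreeIn n a := by
  obtain ⟨m, hm, e⟩ := exists_freeIn_of_freeIn_rename h
  cases e
  exact hm

theorem not_freeIn_zero_shift (a : Tm) : ¬ FreeIn 0 a.shift := by
  intro h
  obtain ⟨m, -, e⟩ := exists_freeIn_of_freeIn_rename h
  cases e

theorem exists_freeIn_of_freeIn_subst {a : Tm} : ∀ {n : ℕ} {σ : ℕ → Tm},
    FreeIn n (a.subst σ) → ∃ m, FreeIn m a ∧ FreeIn n (σ m) := by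
  have up {b : Tm} {n : ℕ} {σ : ℕ → Tm} : (∃ m, FreeIn m b ∧ FreeIn (n + 1) (upSub σ m)) →
      ∃ m, FreeIn (m + 1) b ∧ FreeIn n (σ m) := by
    rintro ⟨_ | m, h, e⟩
    · cases e
    · exact ⟨m, h, freeIn_of_freeIn_shift e⟩
  induction a with
  | lam ρ b ih => intro n σ h; exact up (ih h)
  | pi ρ A B ihA ihB =>
    rintro n σ (h | h)
    · exact (ihA h).imp fun _ h => h.imp .inl id
    · exact (up (ihB h)).imp fun _ h => h.imp .inr id
  | _ => intro n σ h; simp only [subst, FreeIn] at h ⊢ <;> grind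

end Tm

theorem RhoCheck.subst {ρ : Relevance} {b : Tm} (h : RhoCheck ρ b) (σ : ℕ → Tm) :
    RhoCheck ρ (b.subst (Tm.upSub σ)) := by
  cases ρ with
  | rel => trivial
  | irr =>
    intro h0
    obtain ⟨_ | m, hm, h0⟩ := Tm.exists_freeIn_of_freeIn_subst h0
    · exact h hm
    · exact Tm.not_freeIn_zero_shift _ h0

/-- Substitution in a constraint. -/
def EqProp.subst (φ : EqProp) (σ : ℕ → Tm) : EqProp :=
  ⟨φ.lhs.subst σ, φ.rhs.subst σ, φ.ty.subst σ, φ.role⟩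

/-! ### Free variables of well-typed and of role-checked terms -/

mutual

theorem Typing.hasTm_of_freeIn {Γ a A x} : Typing S Γ a A → a.FreeIn x → ∃ B, HasTm Γ x B
  | .var _ _ _ _ h, hx => by cases hx; exact ⟨_, h⟩
  | .pi _ _ _ _ hB hA, hx => by
    rcases hx with hx | hx
    · exact hA.hasTm_of_freeIn hx
    · obtain ⟨_, h⟩ := hB.hasTm_of_freeIn hx
      cases h with | tm _ _ _ _ h => exact ⟨_, h⟩
  | .abs _ _ _ _ _ ha _ _, hx => by
    obtain ⟨_, h⟩ := ha.hasTm_of_freeIn hx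
    cases h with | tm _ _ _ _ h => exact ⟨_, h⟩
  | .app _ _ _ _ _ hb ha, hx => hx.elim hb.hasTm_of_freeIn ha.hasTm_of_freeIn
  | .tapp _ _ _ _ _ _ _ hb ha _, hx => hx.elim hb.hasTm_of_freeIn ha.hasTm_of_freeIn
  | .iapp _ _ _ _ _ hb _, hx => hx.elim hb.hasTm_of_freeIn False.elim
  | .conv _ _ _ _ h _ _, hx => h.hasTm_of_freeIn hx
  | .cpi _ _ _ hB hφ, hx => by
    rcases hx with hx | hx | hx | hx
    · exact hφ.hasTm_of_freeIn (.inl hx)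
    · exact hφ.hasTm_of_freeIn (.inr (.inl hx))
    · exact hφ.hasTm_of_freeIn (.inr (.inr hx))
    · obtain ⟨_, h⟩ := hB.hasTm_of_freeIn hx
      cases h with | co _ _ _ _ h => exact ⟨_, h⟩
  | .cabs _ _ _ _ ha _, hx => by
    obtain ⟨_, h⟩ := ha.hasTm_of_freeIn hx
    cases h with | co _ _ _ _ h => exact ⟨_, h⟩
  | .capp _ _ _ _ _ _ _ h _, hx => h.hasTm_of_freeIn hx
  | .caseOf _ _ _ _ _ _ _ _ _ _ h _ h₁ h₂ _ _, hx =>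
    hx.elim h.hasTm_of_freeIn (Or.elim · h₁.hasTm_of_freeIn h₂.hasTm_of_freeIn)

theorem PropOk.hasTm_of_freeIn {Γ φ x} : PropOk S Γ φ →
    φ.lhs.FreeIn x ∨ φ.rhs.FreeIn x ∨ φ.ty.FreeIn x → ∃ B, HasTm Γ x B
  | .wff _ _ _ _ _ ha hb hA, hx =>
    hx.elim ha.hasTm_of_freeIn (Or.elim · hb.hasTm_of_freeIn hA.hasTm_of_freeIn)

end

theorem Typing.subst_of_nil {a A : Tm} (h : Typing S [] a A) (σ : ℕ → Tm) : a.subst σ = a := by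
  conv_rhs => rw [← a.subst_var]
  refine Tm.subst_congr fun x hx => ?_
  obtain ⟨_, h⟩ := h.hasTm_of_freeIn hx
  cases h

/-- A free variable of a role-checked term has a role. -/
theorem Roleing.getD_of_freeIn {Ω : RoleCtx} {a : Tm} {R : Role} (h : Roleing S Ω a R) :
    ∀ {x : ℕ}, a.FreeIn x → ∃ R', Ω.getD x none = some R' := by
  induction h with
  | var Ω x R R₁ h _ => intro y hy; cases hy; exact ⟨R, h⟩
  | abs _ _ _ _ _ ih => intro x hx; exact ih (x := x + 1) hx
  | app _ _ _ _ _ _ _ ih₁ ih₂ => intro x hx; exact hx.elim ih₁ ih₂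
  | tapp _ _ _ _ _ _ _ ih₁ ih₂ => intro x hx; exact hx.elim ih₁ ih₂
  | pi _ _ _ _ _ _ _ ih₁ ih₂ => intro x hx; exact hx.elim ih₁ (ih₂ (x := x + 1))
  | cabs _ _ _ _ ih => exact ih
  | capp _ _ _ _ ih => exact ih
  | cpi _ _ _ _ _ _ _ _ _ _ _ ih₁ ih₂ ih₃ ih₄ =>
    intro x hx; exact hx.elim ih₁ (Or.elim · ih₂ (Or.elim · ih₃ ih₄))
  | caseOf _ _ _ _ _ _ _ _ _ _ ih₁ ih₂ ih₃ =>
    intro x hx; exact hx.elim ih₁ (Or.elim · ih₂ ih₃)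
  | _ => intro x hx; cases hx

theorem Roleing.lt_length_of_freeIn {Ω : RoleCtx} {a : Tm} {R : Role} (h : Roleing S Ω a R)
    {x : ℕ} (hx : a.FreeIn x) : x < Ω.length := by
  obtain ⟨R', hR'⟩ := h.getD_of_freeIn hx
  by_contra hle
  rw [List.getD_eq_default _ _ (not_lt.1 hle)] at hR'
  cases hR'

/-! ### Declarations of a well-formed signature -/

theorem SigWf.decl_unique {T : Sig} (h : SigWf S T) {F : Const} {d d' : Decl} :
    (F, d) ∈ T → (F, d') ∈ T → d = d' := by
  induction h with
  | empty => intro h; cases h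
  | consConst T G A Rs _ _ hG ih =>
    intro h h'
    simp only [List.mem_cons, Prod.mk.injEq] at h h'
    rcases h with ⟨rfl, rfl⟩ | h <;> rcases h' with ⟨h'', rfl⟩ | h'
    · rfl
    · exact absurd h' (hG _)
    · exact absurd (h'' ▸ h) (hG _)
    · exact ih h h'
  | consAx T G A p R a Γ B Ω _ hG _ _ _ _ ih =>
    intro h h'
    simp only [List.mem_cons, Prod.mk.injEq] at h h'
    rcases h with ⟨rfl, rfl⟩ | h <;> rcases h' with ⟨h'', rfl⟩ | h'
    · rfl
    · exact absurd h' (hG _)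
    · exact absurd (h'' ▸ h) (hG _)
    · exact ih h h'

theorem SigWf.ax_ok {T : Sig} (h : SigWf S T) {F : Const} {A : Tm} {Rs : List Role} {p : Pat}
    {R : Role} {a : Tm} : (F, Decl.ax A Rs p R a) ∈ T →
    ∃ Γ B Ω, Rs = RoleCtx.rng Ω ∧ PatCtx F A p Γ B Ω ∧ Typing S Γ a B ∧ Roleing S Ω a R := by
  induction h with
  | empty => intro h; cases h
  | consConst T G A Rs _ _ hG ih =>
    intro h
    simp only [List.mem_cons, Prod.mk.injEq, reduceCtorEq, and_false, false_or] at h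
    exact ih h
  | consAx T G A p R a Γ B Ω _ hG _ h₁ h₂ h₃ ih =>
    intro h
    simp only [List.mem_cons, Prod.mk.injEq, Decl.ax.injEq] at h
    rcases h with ⟨rfl, rfl, rfl, rfl, rfl, rfl⟩ | h
    · exact ⟨Γ, B, Ω, rfl, h₁, h₂, h₃⟩
    · exact ih h

/-- The declared type of a name. -/
def Decl.ty : Decl → Tm
  | const A _ => A
  | ax A _ _ _ _ => A

/-- The declared parameter roles of a name. -/
def Decl.roles : Decl → List Role
  | const _ Rs => Rs
  | ax _ Rs _ _ _ => Rs

theorem SigWf.typing_ty {T : Sig} (h : SigWf S T) {F : Const} {d : Decl} :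
    (F, d) ∈ T → Typing S [] d.ty .star := by
  induction h with
  | empty => intro h; cases h
  | consConst T G A Rs _ hA _ ih =>
    intro h
    simp only [List.mem_cons, Prod.mk.injEq] at h
    rcases h with ⟨rfl, rfl⟩ | h
    · exact hA
    · exact ih h
  | consAx T G A p R a Γ B Ω _ _ hA _ _ _ ih =>
    intro h
    simp only [List.mem_cons, Prod.mk.injEq] at h
    rcases h with ⟨rfl, rfl⟩ | h
    · exact hA
    · exact ih h

/-! ### Matching and paths -/

theorem PatMatch.length_eq {a : Tm} {p : Pat} {τ : List Tm} {F : Const} {A B : Tm} {Γ : Context}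
    {Ω : RoleCtx} (h : PatMatch a p τ) : PatCtx F A p Γ B Ω → τ.length = Ω.length := by
  induction h generalizing Γ B Ω with
  | fam => intro h; cases h; rfl
  | app _ _ _ _ _ _ ih => intro h; cases h <;> simp [ih ‹_›]
  | capp _ _ _ _ ih => intro h; cases h with | cpi _ _ _ _ _ h => exact ih h

theorem PatMatch.subst {a : Tm} {p : Pat} {τ : List Tm} (h : PatMatch a p τ) (σ : ℕ → Tm) :
    PatMatch (a.subst σ) p (τ.map (Tm.subst σ)) := by
  induction h with
  | fam F => exact .fam F
  | app _ _ _ _ _ _ ih => exact .app _ _ _ _ _ ih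
  | capp _ _ _ _ ih => exact .capp _ _ _ ih

theorem Tm.env_eq_of_lt {l : List Tm} {x : ℕ} (h : x < l.length) : env l x = l[x] := by
  induction l generalizing x with
  | nil => cases h
  | cons t l ih =>
    cases x with
    | zero => rfl
    | succ x => exact ih (Nat.lt_of_succ_lt_succ h)

/-- The right-hand side of an axiom has no variables besides those of the pattern, so that
unfolding the axiom commutes with substitution. -/
theorem MatchSubst.subst (hS : SigOk S) {F : Const} {A : Tm} {Rs : List Role} {p : Pat}
    {R : Role} {a b b' : Tm} (hF : (F, Decl.ax A Rs p R b) ∈ S) (h : MatchSubst a p b b')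
    (σ : ℕ → Tm) : MatchSubst (a.subst σ) p b (b'.subst σ) := by
  obtain ⟨τ, hτ, rfl⟩ := h
  obtain ⟨Γ, B, Ω, -, hp, -, hR⟩ := SigWf.ax_ok hS hF
  refine ⟨_, hτ.subst σ, ?_⟩
  rw [Tm.subst_subst]
  refine Tm.subst_congr fun x hx => ?_
  have hlt : x < τ.length := by rw [hτ.length_eq hp]; exact hR.lt_length_of_freeIn hx
  rw [Tm.env_eq_of_lt hlt, Tm.env_eq_of_lt (by simpa using hlt), List.getElem_map]

theorem ValuePath.subst {a : Tm} {F : Const} (h : ValuePath S a F) (σ : ℕ → Tm) :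
    ValuePath S (a.subst σ) F := by
  induction h with
  | absConst _ _ _ h => exact .absConst _ _ _ h
  | const _ _ _ _ _ _ h => exact .const _ _ _ _ _ _ h
  | app _ _ _ _ _ ih => exact .app _ _ _ _ ih
  | capp _ _ _ ih => exact .capp _ _ ih

theorem ValuePath.patMatch_of_subst {a : Tm} {F : Const} (h : ValuePath S a F) {σ : ℕ → Tm} :
    ∀ {p : Pat} {τ : List Tm}, PatMatch (a.subst σ) p τ → ∃ τ', PatMatch a p τ' := by
  induction h with
  | absConst _ _ _ _ => intro p τ h; exact ⟨_, h⟩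
  | const _ _ _ _ _ _ _ => intro p τ h; exact ⟨_, h⟩
  | app _ _ _ _ _ ih =>
    intro p τ h
    cases h with
    | app _ _ _ _ _ h => obtain ⟨_, h⟩ := ih h; exact ⟨_, .app _ _ _ _ _ h⟩
  | capp _ _ _ ih =>
    intro p τ h
    cases h with
    | capp _ _ _ h => obtain ⟨_, h⟩ := ih h; exact ⟨_, .capp _ _ _ h⟩

theorem ValuePath.subPatMatch_of_subst {a : Tm} {F : Const} (h : ValuePath S a F) {σ : ℕ → Tm}
    {p : Pat} : SubPatMatch (a.subst σ) p → SubPatMatch a p := by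
  have base {a : Tm} (h : ValuePath S a F) {τ : List Tm} (hm : PatMatch (a.subst σ) p τ) :
      SubPatMatch a p := (h.patMatch_of_subst hm).elim fun _ hm => .base _ _ _ hm
  intro hm
  induction h with
  | absConst _ _ _ _ => exact hm
  | const _ _ _ _ _ _ _ => exact hm
  | app _ _ _ _ h ih =>
    cases hm with
    | base _ _ _ hm => exact base (.app _ _ _ _ h) hm
    | app _ _ _ _ hm => exact .app _ _ _ _ (ih base hm)
  | capp _ _ h ih =>
    cases hm with
    | base _ _ _ hm => exact base (.capp _ _ h) hm
    | capp _ _ hm => exact .capp _ _ (ih base hm)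

theorem CasePath.subst {R : Role} {a : Tm} {F : Const} (h : CasePath S R a F) (σ : ℕ → Tm) :
    CasePath S R (a.subst σ) F := by
  cases h with
  | absConst _ _ h hF => exact .absConst _ _ _ _ _ (h.subst σ) hF
  | const _ _ _ _ _ h hF hR => exact .const _ _ _ _ _ _ _ _ (h.subst σ) hF hR
  | unMatch _ _ _ _ _ h hF hR hm =>
    exact .unMatch _ _ _ _ _ _ _ _ (h.subst σ) hF hR (mt h.subPatMatch_of_subst hm)

theorem CasePath.valuePath {R : Role} {a : Tm} {F : Const} (h : CasePath S R a F) :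
    ValuePath S a F := by
  cases h <;> assumption

theorem Value.subst {R : Role} {a : Tm} (h : Value S R a) :
    ∀ σ : ℕ → Tm, Value S R (a.subst σ) := by
  induction h with
  | star => intro; exact .star _
  | pi => intro; exact .pi _ _ _ _
  | cpi φ => intro σ; exact .cpi _ (φ.subst σ) _
  | lamRel => intro; exact .lamRel _ _
  | lamIrr _ _ ih => intro; exact .lamIrr _ _ (ih _)
  | clam => intro; exact .clam _ _
  | path _ _ h => intro σ; exact .path _ _ _ (h.subst σ)

theorem RolePath.subst {a : Tm} {Rs : List Role} (h : RolePath S a Rs) (σ : ℕ → Tm) :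
    RolePath S (a.subst σ) Rs := by
  induction h with
  | absConst _ _ _ h => exact .absConst _ _ _ h
  | const _ _ _ _ _ _ h => exact .const _ _ _ _ _ _ h
  | tapp _ _ _ _ _ ih => exact .tapp _ _ _ _ ih
  | app _ _ _ _ _ ih => exact .app _ _ _ _ ih
  | iapp _ _ _ ih => exact .iapp _ _ ih
  | capp _ _ _ ih => exact .capp _ _ ih

theorem AppsPath.subst {R : Role} {a : Tm} {F : Const} {υs : List AnyFlag}
    (h : AppsPath S R a F υs) (σ : ℕ → Tm) : AppsPath S R (a.subst σ) F υs := by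
  induction h with
  | absConst _ _ _ h => exact .absConst _ _ _ _ h
  | const _ _ _ _ _ _ h hR => exact .const _ _ _ _ _ _ _ h hR
  | app _ _ _ _ _ _ ih => exact .app _ _ _ _ _ _ ih
  | capp _ _ _ _ ih => exact .capp _ _ _ _ ih

theorem ValuePath.appsPath_of_subst {R : Role} {a : Tm} {F : Const} (h : ValuePath S a F)
    {σ : ℕ → Tm} {G : Const} : ∀ {υs : List AnyFlag},
    AppsPath S R (a.subst σ) G υs → AppsPath S R a G υs := by
  induction h with
  | absConst _ _ _ _ => intro υs h; exact h
  | const _ _ _ _ _ _ _ => intro υs h; exact h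
  | app _ _ _ _ _ ih =>
    intro υs h
    cases h with
    | app _ _ _ _ _ h => exact .app _ _ _ _ _ _ (ih h)
  | capp _ _ _ ih =>
    intro υs h
    cases h with
    | capp _ _ _ h => exact .capp _ _ _ _ (ih h)

/-- A value that is not an application path of a given shape does not become one by
substitution. -/
theorem Value.appsPath_of_subst {R R' : Role} {a : Tm} (hv : Value S R a) {σ : ℕ → Tm}
    {F : Const} {υs : List AnyFlag} (h : AppsPath S R' (a.subst σ) F υs) :
    AppsPath S R' a F υs := by
  cases hv with
  | path _ _ hp => exact hp.valuePath.appsPath_of_subst h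
  | _ => cases h

theorem ApplyArgs.subst {a b b' : Tm} (h : ApplyArgs a b b') (σ : ℕ → Tm) :
    ApplyArgs (a.subst σ) (b.subst σ) (b'.subst σ) := by
  induction h with
  | const => exact .const _ _
  | appRole _ _ _ _ _ _ ih => exact .appRole _ _ _ _ _ ih
  | appRho _ _ _ _ _ _ ih => exact .appRho _ _ _ _ _ ih
  | capp _ _ _ _ ih => exact .capp _ _ _ ih

theorem Beta.subst (hS : SigOk S) {R : Role} {a b : Tm} (h : Beta S R a b) (σ : ℕ → Tm) :
    Beta S R (a.subst σ) (b.subst σ) := by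
  cases h with
  | appAbs ρ v b h =>
    rw [Tm.inst_subst]
    exact .appAbs _ _ _ _ (h.subst σ)
  | cappCAbs => exact .cappCAbs _ _
  | axiomStep _ _ _ _ _ _ _ _ hF hm hR =>
    exact .axiomStep _ _ _ _ _ _ _ _ _ hF (hm.subst hS hF σ) hR
  | patternTrue _ _ _ _ _ _ h h' => exact .patternTrue _ _ _ _ _ _ _ (h.subst σ) (h'.subst σ)
  | patternFalse _ _ _ _ _ hv h =>
    exact .patternFalse _ _ _ _ _ _ (hv.subst σ) (mt hv.appsPath_of_subst h)

theorem BranchTyping.subst {υs : List AnyFlag} {R : Role} {a A w A₁ B C : Tm}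
    (h : BranchTyping υs R a A w A₁ B C) : ∀ σ : ℕ → Tm,
    BranchTyping υs R (a.subst σ) (A.subst σ) (w.subst σ) (A₁.subst σ) (B.subst σ)
      (C.subst σ) := by
  induction h with
  | base => intro σ; exact .base _ _ _ _ _
  | piRole _ _ _ _ _ _ _ _ _ _ _ ih =>
    intro σ; refine .piRole _ _ _ _ _ _ _ _ _ _ ?_; simpa [Tm.subst, Tm.upSub] using ih (Tm.upSub σ)
  | piRel _ _ _ _ _ _ _ _ _ _ ih =>
    intro σ; refine .piRel _ _ _ _ _ _ _ _ _ ?_; simpa [Tm.subst, Tm.upSub] using ih (Tm.upSub σ)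
  | piIrrel _ _ _ _ _ _ _ _ _ _ ih =>
    intro σ; refine .piIrrel _ _ _ _ _ _ _ _ _ ?_; simpa [Tm.subst, Tm.upSub] using ih (Tm.upSub σ)
  | cPi _ _ _ _ _ φ _ _ _ _ ih => intro σ; exact .cPi _ _ _ _ _ (φ.subst σ) _ _ _ (ih σ)

/-! ### Substitution for the judgments -/

/-- The equation stated by a constraint holds definitionally. -/
abbrev EqProp.Holds (S : Sig) (Γ : Context) (Δ : Avail) (φ : EqProp) : Prop :=
  DefEq S Γ Δ φ.lhs φ.rhs φ.ty φ.role

/-- A class `P Γ Δ Γ' Δ' σ` of substitutions `σ` from `Γ; Δ` to `Γ'; Δ'` that is closed under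
passing below binders and sends declared variables to well-typed terms and available assumptions
to derivable equations. Renamings form such a class, and so do, by weakening, the well-typed
substitutions; one induction over the judgments serves both. -/
structure IsSubstClass (S : Sig)
    (P : Context → Avail → Context → Avail → (ℕ → Tm) → Prop) : Prop where
  ctxOk {Γ Δ Γ' Δ' σ} : P Γ Δ Γ' Δ' σ → CtxOk S Γ'
  var {Γ Δ Γ' Δ' σ x A} : P Γ Δ Γ' Δ' σ → HasTm Γ x A → Typing S Γ' (σ x) (A.subst σ)
  co {Γ Δ Γ' Δ' σ c φ} : P Γ Δ Γ' Δ' σ → HasCo Γ c φ → c ∈ Δ → (φ.subst σ).Holds S Γ' Δ'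
  avail {Γ Δ Γ' Δ' σ} : P Γ Δ Γ' Δ' σ → P Γ (avail Γ) Γ' (avail Γ') σ
  liftTm {Γ Δ Γ' Δ' σ A} : P Γ Δ Γ' Δ' σ → Typing S Γ' (A.subst σ) .star →
    P (.tm A :: Γ) Δ (.tm (A.subst σ) :: Γ') Δ' (Tm.upSub σ)
  liftCo {Γ Δ Γ' Δ' σ φ} : P Γ Δ Γ' Δ' σ → PropOk S Γ' (φ.subst σ) →
    P (.co φ :: Γ) Δ.lift (.co (φ.subst σ) :: Γ') Δ'.lift σ

section

variable {P : Context → Avail → Context → Avail → (ℕ → Tm) → Prop}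

mutual

theorem Typing.map (hS : SigOk S) (hP : IsSubstClass S P) {Γ a A} : Typing S Γ a A →
    ∀ {Δ Γ' Δ' σ}, P Γ Δ Γ' Δ' σ → Typing S Γ' (a.subst σ) (A.subst σ)
  | .star _ _, _, _, _, _, h => .star _ (hP.ctxOk h)
  | .var _ _ _ _ hx, _, _, _, _, h => hP.var h hx
  | .pi _ _ _ _ hB hA, _, _, _, _, h =>
    .pi _ _ _ _ (hB.map hS hP (hP.liftTm h (hA.map hS hP h))) (hA.map hS hP h)
  | .abs _ _ _ _ _ ha hA hρ, _, _, _, σ, h =>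
    .abs _ _ _ _ _ (ha.map hS hP (hP.liftTm h (hA.map hS hP h))) (hA.map hS hP h) (hρ.subst σ)
  | .app _ _ _ _ _ hb ha, _, _, _, _, h => by
    rw [Tm.inst_subst]; exact .app _ _ _ _ _ (hb.map hS hP h) (ha.map hS hP h)
  | .tapp _ _ _ _ _ _ _ hb ha hR, _, _, _, σ, h => by
    rw [Tm.inst_subst]
    exact .tapp _ _ _ _ _ _ _ (hb.map hS hP h) (ha.map hS hP h) (hR.subst σ)
  | .iapp _ _ _ _ _ hb ha, _, _, _, _, h => by
    rw [Tm.inst_subst]; exact .iapp _ _ _ _ _ (hb.map hS hP h) (ha.map hS hP h)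
  | .conv _ _ _ _ ha hAB hB, _, _, _, _, h =>
    .conv _ _ _ _ (ha.map hS hP h) (hAB.map hS hP (hP.avail h)) (hB.map hS hP h)
  | .cpi _ φ _ hB hφ, _, _, _, σ, h =>
    .cpi _ (φ.subst σ) _ (hB.map hS hP (hP.liftCo h (hφ.map hS hP h))) (hφ.map hS hP h)
  | .cabs _ φ _ _ ha hφ, _, _, _, σ, h =>
    .cabs _ (φ.subst σ) _ _ (ha.map hS hP (hP.liftCo h (hφ.map hS hP h))) (hφ.map hS hP h)
  | .capp _ _ _ _ _ _ _ ha hab, _, _, _, _, h =>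
    .capp _ _ _ _ _ _ _ (ha.map hS hP h) (hab.map hS hP (hP.avail h))
  | .const _ _ _ _ _ hF hA, _, _, _, _, h => by
    rw [hA.subst_of_nil]; exact .const _ _ _ _ (hP.ctxOk h) hF hA
  | .fam _ _ _ _ _ _ _ _ hF hA, _, _, _, _, h => by
    rw [hA.subst_of_nil]; exact .fam _ _ _ _ _ _ _ (hP.ctxOk h) hF hA
  | .caseOf _ _ _ _ _ _ _ _ _ _ ha hF hb₁ hb₂ hB hs, _, _, _, σ, h =>
    .caseOf _ _ _ _ _ _ _ _ _ _ (ha.map hS hP h) (hF.map hS hP h) (hb₁.map hS hP h)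
      (hb₂.map hS hP h) (hB.subst σ) hs

theorem PropOk.map (hS : SigOk S) (hP : IsSubstClass S P) {Γ φ} : PropOk S Γ φ →
    ∀ {Δ Γ' Δ' σ}, P Γ Δ Γ' Δ' σ → PropOk S Γ' (φ.subst σ)
  | .wff _ _ _ _ _ ha hb hA, _, _, _, _, h =>
    .wff _ _ _ _ _ (ha.map hS hP h) (hb.map hS hP h) (hA.map hS hP h)

theorem Iso.map (hS : SigOk S) (hP : IsSubstClass S P) {Γ Δ φ ψ} : Iso S Γ Δ φ ψ →
    ∀ {Γ' Δ' σ}, P Γ Δ Γ' Δ' σ → Iso S Γ' Δ' (φ.subst σ) (ψ.subst σ)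
  | .propCong _ _ _ _ _ _ _ _ h₁ h₂, _, _, _, h =>
    .propCong _ _ _ _ _ _ _ _ (h₁.map hS hP h) (h₂.map hS hP h)
  | .isoConv _ _ _ _ _ _ _ h₁ h₂ h₃, _, _, _, h =>
    .isoConv _ _ _ _ _ _ _ (h₁.map hS hP h) (h₂.map hS hP h) (h₃.map hS hP h)
  | .cpiFst _ _ φ ψ _ _ _ h₁, _, _, σ, h =>
    .cpiFst _ _ (φ.subst σ) (ψ.subst σ) _ _ _ (h₁.map hS hP h)

theorem DefEq.map (hS : SigOk S) (hP : IsSubstClass S P) {Γ Δ a b A R} : DefEq S Γ Δ a b A R →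
    ∀ {Γ' Δ' σ}, P Γ Δ Γ' Δ' σ → DefEq S Γ' Δ' (a.subst σ) (b.subst σ) (A.subst σ) R
  | .assn _ _ _ _ _ _ _ _ hc hΔ, _, _, _, h => hP.co h hc hΔ
  | .refl _ _ _ _ _ ha, _, _, _, h => .refl _ _ _ _ _ (ha.map hS hP h)
  | .symm _ _ _ _ _ _ h₁, _, _, _, h => .symm _ _ _ _ _ _ (h₁.map hS hP h)
  | .trans _ _ _ _ _ _ _ h₁ h₂, _, _, _, h =>
    .trans _ _ _ _ _ _ _ (h₁.map hS hP h) (h₂.map hS hP h)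
  | .sub _ _ _ _ _ _ _ h₁ hR, _, _, _, h => .sub _ _ _ _ _ _ _ (h₁.map hS hP h) hR
  | .beta _ _ _ _ _ _ ha hb hab, _, _, σ, h =>
    .beta _ _ _ _ _ _ (ha.map hS hP h) (hb.map hS hP h) (hab.subst hS σ)
  | .piCong _ _ _ _ _ _ _ _ h₁ h₂ h₃ h₄ h₅, _, _, _, h =>
    .piCong _ _ _ _ _ _ _ _ (h₁.map hS hP h) (h₂.map hS hP (hP.liftTm h (h₃.map hS hP h)))
      (h₃.map hS hP h) (h₄.map hS hP h) (h₅.map hS hP h)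
  | .absCong _ _ _ _ _ _ _ _ h₁ h₂ h₃ h₄, _, _, σ, h =>
    .absCong _ _ _ _ _ _ _ _ (h₁.map hS hP (hP.liftTm h (h₂.map hS hP h))) (h₂.map hS hP h)
      (h₃.subst σ) (h₄.subst σ)
  | .appCong _ _ _ _ _ _ _ _ _ h₁ h₂, _, _, _, h => by
    rw [Tm.inst_subst]; exact .appCong _ _ _ _ _ _ _ _ _ (h₁.map hS hP h) (h₂.map hS hP h)
  | .tappCong _ _ _ _ _ _ _ _ _ _ _ _ h₁ h₂ h₃ h₄ h₅, _, _, σ, h => by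
    have h₅ := h₅.map hS hP h
    rw [Tm.inst_subst] at h₅ ⊢
    exact .tappCong _ _ _ _ _ _ _ _ _ _ _ _ (h₁.map hS hP h) (h₂.map hS hP h) (h₃.subst σ)
      (h₄.subst σ) h₅
  | .iappCong _ _ _ _ _ _ _ _ h₁ h₂, _, _, _, h => by
    rw [Tm.inst_subst]; exact .iappCong _ _ _ _ _ _ _ _ (h₁.map hS hP h) (h₂.map hS hP h)
  | .piFst _ _ _ _ _ _ _ _ h₁, _, _, _, h => .piFst _ _ _ _ _ _ _ _ (h₁.map hS hP h)
  | .piSnd _ _ _ _ _ _ _ _ _ _ h₁ h₂, _, _, _, h => by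
    rw [Tm.inst_subst, Tm.inst_subst]
    exact .piSnd _ _ _ _ _ _ _ _ _ _ (h₁.map hS hP h) (h₂.map hS hP h)
  | .cpiCong _ _ φ ψ _ _ _ h₁ h₂ h₃ h₄ h₅, _, _, σ, h =>
    .cpiCong _ _ (φ.subst σ) (ψ.subst σ) _ _ _ (h₁.map hS hP h)
      (h₂.map hS hP (hP.liftCo h (h₃.map hS hP h))) (h₃.map hS hP h) (h₄.map hS hP h)
      (h₅.map hS hP h)
  | .cabsCong _ _ φ _ _ _ _ h₁ h₂, _, _, σ, h =>
    .cabsCong _ _ (φ.subst σ) _ _ _ _ (h₁.map hS hP (hP.liftCo h (h₂.map hS hP h)))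
      (h₂.map hS hP h)
  | .cappCong _ _ _ _ _ _ _ _ _ _ h₁ h₂, _, _, _, h =>
    .cappCong _ _ _ _ _ _ _ _ _ _ (h₁.map hS hP h) (h₂.map hS hP (hP.avail h))
  | .cpiSnd _ _ _ _ _ _ _ _ _ _ _ _ _ h₁ h₂ h₃, _, _, _, h =>
    .cpiSnd _ _ _ _ _ _ _ _ _ _ _ _ _ (h₁.map hS hP h) (h₂.map hS hP (hP.avail h))
      (h₃.map hS hP (hP.avail h))
  | .cast _ _ _ _ _ _ _ _ _ _ h₁ h₂, _, _, _, h =>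
    .cast _ _ _ _ _ _ _ _ _ _ (h₁.map hS hP h) (h₂.map hS hP h)
  | .eqConv _ _ _ _ _ _ _ h₁ h₂ h₃, _, _, _, h =>
    .eqConv _ _ _ _ _ _ _ (h₁.map hS hP h) (h₂.map hS hP (hP.avail h)) (h₃.map hS hP h)
  | .isoSnd _ _ _ _ _ _ _ _ _ _ h₁, _, _, _, h =>
    .isoSnd _ _ _ _ _ _ _ _ _ _ (h₁.map hS hP h)
  | .patCong _ _ _ _ _ _ _ _ _ _ _ _ _ _ _ _ h₁ h₂ h₃ h₄ h₅ h₆ h₇ h₈ h₉ h₁₀ h₁₁ h₁₂,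
      _, _, σ, h =>
    .patCong _ _ _ _ _ _ _ _ _ _ _ _ _ _ _ _ (h₁.map hS hP h) (h₂.map hS hP h)
      (h₃.map hS hP h) (h₄.map hS hP h) (h₅.map hS hP h) (h₆.map hS hP h) (h₇.subst σ)
      (h₈.subst σ) (h₉.map hS hP h) (h₁₀.map hS hP h) (h₁₁.map hS hP (hP.avail h)) h₁₂
  | .leftRel _ _ _ _ _ _ _ _ _ _ _ h₁ h₂ h₃ h₄ h₅ h₆ h₇ h₈, _, _, σ, h => by
    have h₇ := h₇.map hS hP h
    have h₈ := h₈.map hS hP (hP.avail h)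
    rw [Tm.inst_subst] at h₇ h₈
    rw [Tm.inst_subst] at h₈
    exact .leftRel _ _ _ _ _ _ _ _ _ _ _ (h₁.subst σ) (h₂.subst σ) (h₃.map hS hP h)
      (h₄.map hS hP h) (h₅.map hS hP h) (h₆.map hS hP h) h₇ h₈
  | .leftIrrel _ _ _ _ _ _ _ _ _ _ h₁ h₂ h₃ h₄ h₅ h₆ h₇ h₈, _, _, σ, h => by
    have h₇ := h₇.map hS hP h
    have h₈ := h₈.map hS hP (hP.avail h)
    rw [Tm.inst_subst] at h₇ h₈
    rw [Tm.inst_subst] at h₈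
    exact .leftIrrel _ _ _ _ _ _ _ _ _ _ (h₁.subst σ) (h₂.subst σ) (h₃.map hS hP h)
      (h₄.map hS hP h) (h₅.map hS hP h) (h₆.map hS hP h) h₇ h₈
  | .right _ _ _ _ _ _ _ _ _ _ _ h₁ h₂ h₃ h₄ h₅ h₆ h₇ h₈, _, _, σ, h => by
    have h₇ := h₇.map hS hP h
    have h₈ := h₈.map hS hP (hP.avail h)
    rw [Tm.inst_subst] at h₇ h₈
    rw [Tm.inst_subst] at h₈
    exact .right _ _ _ _ _ _ _ _ _ _ _ (h₁.subst σ) (h₂.subst σ) (h₃.map hS hP h)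
      (h₄.map hS hP h) (h₅.map hS hP h) (h₆.map hS hP h) h₇ h₈
  | .cLeft _ _ _ _ _ _ _ _ _ _ _ h₁ h₂ h₃ h₄ h₅ h₆, _, _, σ, h =>
    .cLeft _ _ _ _ _ _ _ _ _ _ _ (h₁.subst σ) (h₂.subst σ) (h₃.map hS hP h)
      (h₄.map hS hP h) (h₅.map hS hP (hP.avail h)) (h₆.map hS hP h)

end

end

@[simp] theorem avail_tm (A : Tm) (Γ : Context) : avail (.tm A :: Γ) = avail Γ := by
  ext c
  constructor
  · rintro ⟨_, h⟩; cases h with | tm _ _ φ _ h => exact ⟨φ, h⟩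
  · rintro ⟨φ, h⟩; exact ⟨_, .tm _ _ φ _ h⟩

theorem EqProp.shift_subst_upSub (φ : EqProp) (σ : ℕ → Tm) :
    φ.shift.subst (Tm.upSub σ) = (φ.subst σ).shift := by
  simp [EqProp.shift, EqProp.subst]

/-- The renaming `ξ` of term variables maps `Γ` to `Γ'`, for some renaming of coercion variables
that maps `Δ` into `Δ'`. -/
structure IsRenaming (S : Sig) (Γ : Context) (Δ : Avail) (Γ' : Context) (Δ' : Avail)
    (σ : ℕ → Tm) : Prop where
  ctxOk : CtxOk S Γ'
  var : ∃ ξ : ℕ → ℕ, σ = (fun x => .var (ξ x)) ∧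
    ∀ {x A}, HasTm Γ x A → HasTm Γ' (ξ x) (A.subst σ)
  co : ∃ κ : ℕ → ℕ, (∀ {c φ}, HasCo Γ c φ → HasCo Γ' (κ c) (φ.subst σ)) ∧ ∀ c ∈ Δ, κ c ∈ Δ'

theorem isSubstClass_isRenaming (S : Sig) : IsSubstClass S (IsRenaming S) where
  ctxOk h := h.ctxOk
  var h hx := by
    obtain ⟨ξ, rfl, hξ⟩ := h.var
    exact .var _ _ _ h.ctxOk (hξ hx)
  co h hc hΔ := by
    obtain ⟨κ, hκ, hκΔ⟩ := h.co
    exact .assn _ _ _ _ _ _ _ h.ctxOk (hκ hc) (hκΔ _ hΔ)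
  avail h := by
    obtain ⟨κ, hκ, -⟩ := h.co
    refine ⟨h.ctxOk, h.var, κ, hκ, ?_⟩
    rintro c ⟨φ, hc⟩
    exact ⟨_, hκ hc⟩
  liftTm {Γ Δ Γ' Δ' σ A} h hA := by
    refine ⟨.consTm _ _ h.ctxOk hA, ?_, ?_⟩
    · obtain ⟨ξ, hσ, hξ⟩ := h.var
      refine ⟨Tm.upRen ξ, ?_, ?_⟩
      · subst hσ; funext x; cases x <;> rfl
      · intro x B hx
        cases hx with
        | here => rw [Tm.shift_subst_upSub]; exact .here _ _
        | tm _ _ _ _ hx => rw [Tm.shift_subst_upSub]; exact .tm _ _ _ _ (hξ hx)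
    · obtain ⟨κ, hκ, hκΔ⟩ := h.co
      refine ⟨κ, ?_, hκΔ⟩
      intro c φ hc
      cases hc with
      | tm _ _ _ _ hc => rw [EqProp.shift_subst_upSub]; exact .tm _ _ _ _ (hκ hc)
  liftCo {Γ Δ Γ' Δ' σ φ} h hφ := by
    refine ⟨.consCo _ _ h.ctxOk hφ, ?_, ?_⟩
    · obtain ⟨ξ, hσ, hξ⟩ := h.var
      refine ⟨ξ, hσ, ?_⟩
      intro x B hx
      cases hx with | co _ _ _ _ hx => exact .co _ _ _ _ (hξ hx)
    · obtain ⟨κ, hκ, hκΔ⟩ := h.co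
      refine ⟨Tm.upRen κ, ?_, ?_⟩
      · intro c ψ hc
        cases hc with
        | here => exact .here _ _
        | co _ _ _ _ hc => exact .co _ _ _ _ (hκ hc)
      · rintro _ ⟨c, hc, rfl⟩
        exact ⟨κ c, hκΔ c hc, rfl⟩

@[simp] theorem EqProp.subst_var (φ : EqProp) : φ.subst .var = φ := by simp [EqProp.subst]

theorem EqProp.shift_eq_subst (φ : EqProp) : φ.shift = φ.subst fun x => .var (x + 1) := by
  simp [EqProp.shift, EqProp.subst, Tm.shift_eq_subst]

theorem isRenaming_tm {Γ : Context} {Δ Δ' : Avail} {A : Tm} (hΓ : CtxOk S (.tm A :: Γ))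
    (hΔ : Δ ⊆ Δ') : IsRenaming S Γ Δ (.tm A :: Γ) Δ' fun x => .var (x + 1) := by
  refine ⟨hΓ, ⟨_, rfl, ?_⟩, id, ?_, fun _ h => hΔ h⟩
  · intro x B hx; rw [← Tm.shift_eq_subst]; exact .tm _ _ _ _ hx
  · intro c φ hc; rw [← EqProp.shift_eq_subst]; exact .tm _ _ _ _ hc

theorem isRenaming_co {Γ : Context} {Δ Δ' : Avail} {φ : EqProp} (hΓ : CtxOk S (.co φ :: Γ))
    (hΔ : Δ.lift ⊆ Δ') : IsRenaming S Γ Δ (.co φ :: Γ) Δ' .var := by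
  refine ⟨hΓ, ⟨_, rfl, ?_⟩, Nat.succ, ?_, fun _ h => hΔ ⟨_, h, rfl⟩⟩
  · intro x B hx; rw [Tm.subst_var]; exact .co _ _ _ _ hx
  · intro c φ hc; rw [EqProp.subst_var]; exact .co _ _ _ _ hc

/-! ### Weakening, substitution, generation and regularity -/

theorem Typing.ctxOk {Γ a A} : Typing S Γ a A → CtxOk S Γ
  | .star _ h => h
  | .var _ _ _ h _ => h
  | .pi _ _ _ _ _ h => h.ctxOk
  | .abs _ _ _ _ _ _ h _ => h.ctxOk
  | .app _ _ _ _ _ _ h => h.ctxOk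
  | .tapp _ _ _ _ _ _ _ _ h _ => h.ctxOk
  | .iapp _ _ _ _ _ _ h => h.ctxOk
  | .conv _ _ _ _ h _ _ => h.ctxOk
  | .cpi _ _ _ h _ => by cases h.ctxOk with | consCo _ _ h _ => exact h
  | .cabs _ _ _ _ h _ => by cases h.ctxOk with | consCo _ _ h _ => exact h
  | .capp _ _ _ _ _ _ _ h _ => h.ctxOk
  | .const _ _ _ _ h _ _ => h
  | .fam _ _ _ _ _ _ _ h _ _ => h
  | .caseOf _ _ _ _ _ _ _ _ _ _ h _ _ _ _ _ => h.ctxOk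

theorem PropOk.ctxOk {Γ φ} : PropOk S Γ φ → CtxOk S Γ
  | .wff _ _ _ _ _ h _ _ => h.ctxOk

theorem Typing.weaken_tm (hS : SigOk S) {Γ a A B} (h : Typing S Γ a A)
    (hB : Typing S Γ B .star) : Typing S (.tm B :: Γ) a.shift A.shift := by
  rw [Tm.shift_eq_subst, Tm.shift_eq_subst]
  exact h.map hS (isSubstClass_isRenaming S)
    (isRenaming_tm (Δ := ∅) (.consTm _ _ hB.ctxOk hB) subset_rfl)

theorem Typing.weaken_co (hS : SigOk S) {Γ a A φ} (h : Typing S Γ a A)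
    (hφ : PropOk S Γ φ) : Typing S (.co φ :: Γ) a A := by
  rw [← a.subst_var, ← A.subst_var]
  exact h.map hS (isSubstClass_isRenaming S)
    (isRenaming_co (Δ := ∅) (.consCo _ _ hφ.ctxOk hφ) subset_rfl)

theorem Typing.weaken_nil (hS : SigOk S) {Γ a A} (h : Typing S [] a A) (hΓ : CtxOk S Γ) :
    Typing S Γ a A := by
  rw [← a.subst_var, ← A.subst_var]
  refine h.map (Δ := ∅) (Δ' := ∅) hS (isSubstClass_isRenaming S)
    ⟨hΓ, ⟨_, rfl, ?_⟩, id, ?_, fun _ h => h⟩ <;> (intro _ _ h; cases h)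

theorem DefEq.weaken_tm (hS : SigOk S) {Γ Δ Δ' a b A R B} (h : DefEq S Γ Δ a b A R)
    (hB : Typing S Γ B .star) (hΔ : Δ ⊆ Δ') :
    DefEq S (.tm B :: Γ) Δ' a.shift b.shift A.shift R := by
  simp only [Tm.shift_eq_subst]
  exact h.map hS (isSubstClass_isRenaming S) (isRenaming_tm (.consTm _ _ hB.ctxOk hB) hΔ)

theorem DefEq.weaken_co (hS : SigOk S) {Γ Δ Δ' a b A R φ} (h : DefEq S Γ Δ a b A R)
    (hφ : PropOk S Γ φ) (hΔ : Δ.lift ⊆ Δ') : DefEq S (.co φ :: Γ) Δ' a b A R := by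
  rw [← a.subst_var, ← b.subst_var, ← A.subst_var]
  exact h.map hS (isSubstClass_isRenaming S) (isRenaming_co (.consCo _ _ hφ.ctxOk hφ) hΔ)

theorem DefEq.mono (hS : SigOk S) {Γ Δ Δ' a b A R} (h : DefEq S Γ Δ a b A R)
    (hΓ : CtxOk S Γ) (hΔ : Δ ⊆ Δ') : DefEq S Γ Δ' a b A R := by
  rw [← a.subst_var, ← b.subst_var, ← A.subst_var]
  refine h.map hS (isSubstClass_isRenaming S) ⟨hΓ, ⟨_, rfl, ?_⟩, id, ?_, fun _ h => hΔ h⟩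
  · intro x A h; rwa [Tm.subst_var]
  · intro c φ h; rwa [EqProp.subst_var]

/-- `σ` maps the term variables of `Γ` to terms that are well-typed in `Γ'`, and the assumptions
of `Γ` to derivable equations. Those in `Δ` must be derivable from the assumptions in `Δ'` alone;
the others matter only to typing, where all assumptions of the context are available. -/
structure IsSubst (S : Sig) (Γ : Context) (Δ : Avail) (Γ' : Context) (Δ' : Avail)
    (σ : ℕ → Tm) : Prop where
  ctxOk : CtxOk S Γ'
  var {x A} : HasTm Γ x A → Typing S Γ' (σ x) (A.subst σ)
  co {c φ} : HasCo Γ c φ → c ∈ Δ → (φ.subst σ).Holds S Γ' Δ'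
  co_avail {c φ} : HasCo Γ c φ → (φ.subst σ).Holds S Γ' (SystemDR.avail Γ')

theorem lift_avail_subset (φ : EqProp) (Γ : Context) : (avail Γ).lift ⊆ avail (.co φ :: Γ) := by
  rintro _ ⟨c, ⟨ψ, h⟩, rfl⟩
  exact ⟨ψ, .co _ _ _ _ h⟩

theorem isSubstClass_isSubst (hS : SigOk S) : IsSubstClass S (IsSubst S) where
  ctxOk h := h.ctxOk
  var h := h.var
  co h := h.co
  avail h := ⟨h.ctxOk, h.var, fun hc _ => h.co_avail hc, h.co_avail⟩
  liftTm {Γ Δ Γ' Δ' σ A} h hA := by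
    refine ⟨.consTm _ _ h.ctxOk hA, ?_, ?_, ?_⟩
    · intro x B hx
      cases hx with
      | here =>
        rw [Tm.shift_subst_upSub]; exact .var _ _ _ (.consTm _ _ h.ctxOk hA) (.here _ _)
      | tm _ _ _ _ hx => rw [Tm.shift_subst_upSub]; exact (h.var hx).weaken_tm hS hA
    · intro c φ hc hΔ
      cases hc with
      | tm _ _ _ _ hc =>
        rw [EqProp.shift_subst_upSub]; exact (h.co hc hΔ).weaken_tm hS hA subset_rfl
    · intro c φ hc
      cases hc with
      | tm _ _ _ _ hc =>
        rw [EqProp.shift_subst_upSub, avail_tm]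
        exact (h.co_avail hc).weaken_tm hS hA subset_rfl
  liftCo {Γ Δ Γ' Δ' σ φ} h hφ := by
    have hΓ := CtxOk.consCo _ _ h.ctxOk hφ
    refine ⟨hΓ, ?_, ?_, ?_⟩
    · intro x B hx
      cases hx with | co _ _ _ _ hx => exact (h.var hx).weaken_co hS hφ
    · rintro _ ψ hc ⟨c, hΔ, rfl⟩
      cases hc with | co _ _ _ _ hc => exact (h.co hc hΔ).weaken_co hS hφ subset_rfl
    · intro c ψ hc
      cases hc with
      | here => exact .assn _ _ _ _ _ _ _ hΓ (.here _ _) ⟨_, .here _ _⟩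
      | co _ _ _ _ hc => exact (h.co_avail hc).weaken_co hS hφ (lift_avail_subset _ _)

theorem Tm.env_nil : env [] = var := by funext x; rfl

theorem isSubst_nil {Γ} (hΓ : CtxOk S Γ) (σ : ℕ → Tm) : IsSubst S [] ∅ Γ ∅ σ :=
  ⟨hΓ, nofun, nofun, nofun⟩

theorem isSubst_refl {Γ} (hΓ : CtxOk S Γ) : IsSubst S Γ ∅ Γ ∅ (Tm.env []) := by
  rw [Tm.env_nil]
  refine ⟨hΓ, ?_, nofun, ?_⟩
  · intro x A h; rw [Tm.subst_var]; exact .var _ _ _ hΓ h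
  · intro c φ h; rw [EqProp.subst_var]; exact .assn _ _ _ _ _ _ _ hΓ h ⟨_, h⟩

theorem IsSubst.cons {Γ Γ' l A a} (h : IsSubst S Γ ∅ Γ' ∅ (Tm.env l))
    (ha : Typing S Γ' a (A.subst (Tm.env l))) :
    IsSubst S (.tm A :: Γ) ∅ Γ' ∅ (Tm.env (a :: l)) := by
  refine ⟨h.ctxOk, ?_, nofun, ?_⟩
  · intro x B hx
    cases hx with
    | here => rw [Tm.shift_subst_env]; exact ha
    | tm _ _ _ _ hx => rw [Tm.shift_subst_env]; exact h.var hx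
  · intro c φ hc
    cases hc with
    | tm _ _ _ _ hc =>
      simpa only [EqProp.subst, EqProp.shift, Tm.shift_subst_env] using h.co_avail hc

theorem IsSubst.consCo {Γ Γ' σ φ} (h : IsSubst S Γ ∅ Γ' ∅ σ)
    (hφ : (φ.subst σ).Holds S Γ' (avail Γ')) : IsSubst S (.co φ :: Γ) ∅ Γ' ∅ σ := by
  refine ⟨h.ctxOk, ?_, nofun, ?_⟩
  · intro x B hx
    cases hx with | co _ _ _ _ hx => exact h.var hx
  · intro c ψ hc
    cases hc with
    | here => exact hφ
    | co _ _ _ _ hc => exact h.co_avail hc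

theorem Typing.inst (hS : SigOk S) {Γ A b B a} (h : Typing S (.tm A :: Γ) b B)
    (ha : Typing S Γ a A) : Typing S Γ (b.inst a) (B.inst a) :=
  h.map hS (isSubstClass_isSubst hS)
    ((isSubst_refl ha.ctxOk).cons (by rwa [Tm.env_nil, Tm.subst_var]))

/-- Substitution of `•` for a coercion variable, which leaves the term and its type unchanged. -/
theorem Typing.instCo (hS : SigOk S) {Γ φ b B} (h : Typing S (.co φ :: Γ) b B)
    (hφ : φ.Holds S Γ (avail Γ)) : Typing S Γ b B := by
  have hΓ : CtxOk S Γ := by cases h.ctxOk with | consCo _ _ h _ => exact h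
  rw [← b.subst_var, ← B.subst_var, ← Tm.env_nil]
  refine h.map hS (isSubstClass_isSubst hS) ((isSubst_refl hΓ).consCo ?_)
  rwa [Tm.env_nil, EqProp.subst_var]

/-- Types are equal as far as the conversion rule is concerned. Syntactic equality is included
because reflexivity of definitional equality presupposes a well-typed term. -/
def TyEq (S : Sig) (Γ : Context) (A B : Tm) : Prop :=
  A = B ∨ DefEq S Γ (avail Γ) A B .star .rep

theorem TyEq.trans_defEq {Γ A B C} (h : TyEq S Γ A B)
    (h' : DefEq S Γ (avail Γ) B C .star .rep) : TyEq S Γ A C := by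
  rcases h with rfl | h
  · exact .inr h'
  · exact .inr (.trans _ _ _ _ _ _ _ h h')

theorem TyEq.defEq {Γ A B} (h : TyEq S Γ A B) (hB : Typing S Γ B .star) :
    DefEq S Γ (avail Γ) A B .star .rep := by
  rcases h with rfl | h
  · exact .refl _ _ _ _ _ hB
  · exact h

/-- The relevance of the `Π`-type eliminated by an application with the given flag. -/
def AppFlag.relevance : AppFlag → Relevance
  | role _ => .rel
  | rho ρ => ρ

/-- `ArgOk S b ν a c`: in the application `b a^ν` the argument `a` is the one that is written when
`b` is applied to `c`; that is `c` itself, or `□` when the argument is irrelevant. -/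
inductive ArgOk (S : Sig) (b : Tm) : AppFlag → Tm → Tm → Prop
  | rel (c : Tm) : ArgOk S b (.rho .rel) c c
  | irr (c : Tm) : ArgOk S b (.rho .irr) .box c
  | role (R : Role) (Rs : List Role) (c : Tm) : RolePath S b (R :: Rs) → ArgOk S b (.role R) c c

theorem ArgOk.typing {b ν a c Γ A B} (h : ArgOk S b ν a c)
    (hb : Typing S Γ b (.pi ν.relevance A B)) (hc : Typing S Γ c A) :
    Typing S Γ (.app b ν a) (B.inst c) := by
  cases h with
  | rel => exact .app _ _ _ _ _ hb hc
  | irr => exact .iapp _ _ _ _ _ hb hc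
  | role _ _ _ h => exact .tapp _ _ _ _ _ _ _ hb hc h

/-- What a derivation of `Γ ⊨ a : T` must contain, by the shape of `a`: the premises of the
syntax-directed rule for `a`, whose conclusion has the type `T` up to conversion. -/
def Generation (S : Sig) (Γ : Context) : Tm → Tm → Prop
  | .fam F, T => ∃ d, (F, d) ∈ S ∧ Typing S [] d.ty .star ∧ TyEq S Γ d.ty T
  | .lam ρ b, T => ∃ A B, Typing S (.tm A :: Γ) b B ∧ Typing S Γ A .star ∧ RhoCheck ρ b ∧
      TyEq S Γ (.pi ρ A B) T
  | .app b ν a, T => ∃ A B c, Typing S Γ b (.pi ν.relevance A B) ∧ Typing S Γ c A ∧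
      ArgOk S b ν a c ∧ TyEq S Γ (B.inst c) T
  | .pi _ A B, _ => Typing S Γ A .star ∧ Typing S (.tm A :: Γ) B .star
  | .clam b, T => ∃ φ B, Typing S (.co φ :: Γ) b B ∧ PropOk S Γ φ ∧ TyEq S Γ (φ.all B) T
  | .capp a, T => ∃ (φ : EqProp) (B : Tm), Typing S Γ a (φ.all B) ∧ φ.Holds S Γ (avail Γ) ∧
      TyEq S Γ B T
  | .cpi a b A R B, _ => PropOk S Γ ⟨a, b, A, R⟩ ∧ Typing S (.co ⟨a, b, A, R⟩ :: Γ) B .star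
  | .caseOf a F υs b₁ b₂, T => ∃ A A₁ B C, Typing S Γ a A ∧ Typing S Γ (.fam F) A₁ ∧
      Typing S Γ b₁ B ∧ Typing S Γ b₂ C ∧ BranchTyping υs .nom a A (.fam F) A₁ B C ∧
      SatApp S F υs ∧ TyEq S Γ C T
  | _, _ => True

theorem Generation.conv {Γ a A B} (h : Generation S Γ a A)
    (hAB : DefEq S Γ (avail Γ) A B .star .rep) : Generation S Γ a B := by
  cases a with
  | star | var | box => trivial
  | pi | cpi => exact h
  | fam => obtain ⟨d, h₁, h₂, h₃⟩ := h; exact ⟨d, h₁, h₂, h₃.trans_defEq hAB⟩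
  | lam => obtain ⟨A, B, h₁, h₂, h₃, h₄⟩ := h; exact ⟨A, B, h₁, h₂, h₃, h₄.trans_defEq hAB⟩
  | app => obtain ⟨A, B, c, h₁, h₂, h₃, h₄⟩ := h; exact ⟨A, B, c, h₁, h₂, h₃, h₄.trans_defEq hAB⟩
  | clam => obtain ⟨φ, B, h₁, h₂, h₃⟩ := h; exact ⟨φ, B, h₁, h₂, h₃.trans_defEq hAB⟩
  | capp => obtain ⟨φ, B, h₁, h₂, h₃⟩ := h; exact ⟨φ, B, h₁, h₂, h₃.trans_defEq hAB⟩
  | caseOf =>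
    obtain ⟨A, A₁, B, C, h₁, h₂, h₃, h₄, h₅, h₆, h₇⟩ := h
    exact ⟨A, A₁, B, C, h₁, h₂, h₃, h₄, h₅, h₆, h₇.trans_defEq hAB⟩

theorem Typing.generation {Γ a T} : Typing S Γ a T → Generation S Γ a T
  | .star _ _ => trivial
  | .var _ _ _ _ _ => trivial
  | .pi _ _ _ _ h₁ h₂ => ⟨h₂, h₁⟩
  | .abs _ _ _ _ _ h₁ h₂ h₃ => ⟨_, _, h₁, h₂, h₃, .inl rfl⟩
  | .app _ _ _ _ _ h₁ h₂ => ⟨_, _, _, h₁, h₂, .rel _, .inl rfl⟩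
  | .tapp _ _ _ _ _ _ _ h₁ h₂ h₃ => ⟨_, _, _, h₁, h₂, .role _ _ _ h₃, .inl rfl⟩
  | .iapp _ _ _ _ _ h₁ h₂ => ⟨_, _, _, h₁, h₂, .irr _, .inl rfl⟩
  | .conv _ _ _ _ h₁ h₂ _ => h₁.generation.conv h₂
  | .cpi _ _ _ h₁ h₂ => ⟨h₂, h₁⟩
  | .cabs _ _ _ _ h₁ h₂ => ⟨_, _, h₁, h₂, .inl rfl⟩
  | .capp _ _ a b A R _ h₁ h₂ => ⟨⟨a, b, A, R⟩, _, h₁, h₂, .inl rfl⟩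
  | .const _ _ _ _ _ h₁ h₂ => ⟨_, h₁, h₂, .inl rfl⟩
  | .fam _ _ _ _ _ _ _ _ h₁ h₂ => ⟨_, h₁, h₂, .inl rfl⟩
  | .caseOf _ _ _ _ _ _ _ _ _ _ h₁ h₂ h₃ h₄ h₅ h₆ => ⟨_, _, _, _, h₁, h₂, h₃, h₄, h₅, h₆, .inl rfl⟩

theorem HasTm.typing_star (hS : SigOk S) {Γ x A} (h : HasTm Γ x A) :
    CtxOk S Γ → Typing S Γ A .star := by
  induction h with
  | here => intro hΓ; cases hΓ with | consTm _ _ _ hA => exact hA.weaken_tm hS hA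
  | tm _ _ _ _ _ ih => intro hΓ; cases hΓ with | consTm _ _ hΓ hB => exact (ih hΓ).weaken_tm hS hB
  | co _ _ _ _ _ ih => intro hΓ; cases hΓ with | consCo _ _ hΓ hφ => exact (ih hΓ).weaken_co hS hφ

/-- Regularity: the type of a well-typed term is a type. -/
theorem Typing.typing_star (hS : SigOk S) {Γ a A} : Typing S Γ a A → Typing S Γ A .star
  | .star _ h => .star _ h
  | .var _ _ _ hΓ h => h.typing_star hS hΓ
  | .pi _ _ _ _ _ h => .star _ h.ctxOk
  | .abs _ _ _ _ _ h₁ h₂ _ => .pi _ _ _ _ (h₁.typing_star hS) h₂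
  | .app _ _ _ _ _ h₁ h₂ => (h₁.typing_star hS).generation.2.inst hS h₂
  | .tapp _ _ _ _ _ _ _ h₁ h₂ _ => (h₁.typing_star hS).generation.2.inst hS h₂
  | .iapp _ _ _ _ _ h₁ h₂ => (h₁.typing_star hS).generation.2.inst hS h₂
  | .conv _ _ _ _ _ _ h => h
  | .cpi _ _ _ _ h => .star _ h.ctxOk
  | .cabs _ _ _ _ h₁ h₂ => .cpi _ _ _ (h₁.typing_star hS) h₂
  | .capp _ _ _ _ _ _ _ h₁ h₂ => (h₁.typing_star hS).generation.2.instCo hS h₂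
  | .const _ _ _ _ hΓ _ h => h.weaken_nil hS hΓ
  | .fam _ _ _ _ _ _ _ hΓ _ h => h.weaken_nil hS hΓ
  | .caseOf _ _ _ _ _ _ _ _ _ _ _ _ _ h _ _ => h.typing_star hS

/-! ### Unfolding of axioms -/

theorem Typing.conv_symm {Γ a A B} (h : Typing S Γ a B)
    (hAB : DefEq S Γ (avail Γ) A B .star .rep) (hA : Typing S Γ A .star) : Typing S Γ a A :=
  .conv _ _ _ _ h (.symm _ _ _ _ _ _ hAB) hA

/-- If `Π^ρ A → B` and `Π^ρ A' → B'` are equal, a term of type `A'` also has type `A`, and it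
instantiates `B` and `B'` to equal types. No consistency is involved: `piFst` and `piSnd` are rules
of definitional equality. -/
theorem Typing.pi_conv {Γ ρ A B A' B' c} (hc : Typing S Γ c A')
    (h : DefEq S Γ (avail Γ) (.pi ρ A B) (.pi ρ A' B') .star .rep)
    (hpi : Typing S Γ (.pi ρ A B) .star) :
    Typing S Γ c A ∧ DefEq S Γ (avail Γ) (B.inst c) (B'.inst c) .star .rep := by
  have hcA := hc.conv_symm (.piFst _ _ _ _ _ _ _ _ h) hpi.generation.1
  exact ⟨hcA, .piSnd _ _ _ _ _ _ _ _ _ _ h (.refl _ _ _ _ _ hcA)⟩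

/-- The analogue for `∀`: the constraint of an equal `∀`-type holds, and the bodies are equal. -/
theorem EqProp.Holds.cpi_conv {Γ} {φ ψ : EqProp} {B C : Tm} (hψ : ψ.Holds S Γ (avail Γ))
    (h : DefEq S Γ (avail Γ) (φ.all B) (ψ.all C) .star .rep) :
    φ.Holds S Γ (avail Γ) ∧ DefEq S Γ (avail Γ) B C .star .rep := by
  have hφ : φ.Holds S Γ (avail Γ) :=
    .cast _ _ _ _ _ _ _ _ _ _ hψ (.cpiFst _ _ _ _ _ _ _ (.symm _ _ _ _ _ _ h))
  exact ⟨hφ, .cpiSnd _ _ _ _ _ _ _ _ _ _ _ _ _ h hφ hψ⟩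

theorem Typing.fam_tyEq (hS : SigOk S) {Γ F d T} (hF : (F, d) ∈ S)
    (h : Typing S Γ (.fam F) T) :
    Typing S [] d.ty .star ∧ DefEq S Γ (avail Γ) d.ty T .star .rep := by
  obtain ⟨d', hd', h₁, h₂⟩ := h.generation
  obtain rfl := SigWf.decl_unique hS hF hd'
  exact ⟨h₁, h₂.defEq (h.typing_star hS)⟩

/-- The type of a pattern is well-formed in the context of its variables. -/
theorem PatCtx.typing_star {F A p Γ B Ω} (h : PatCtx F A p Γ B Ω) (hA : Typing S [] A .star) :
    Typing S Γ B .star := by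
  induction h with
  | const => exact hA
  | piRole _ _ _ _ _ _ _ ih => exact ih.generation.2
  | piRel _ _ _ _ _ _ ih => exact ih.generation.2
  | piIrr _ _ _ _ _ _ ih => exact ih.generation.2
  | cpi _ _ _ _ _ _ ih => exact ih.generation.2

/-- The arguments of a well-typed term that matches the pattern of its head form a well-typed
substitution for the variables of the pattern. For an irrelevant argument the substitution takes a
term elided in favour of `□`, so it agrees with the matching substitution `τ` only at the
variables that have a role. -/
theorem PatMatch.exists_isSubst (hS : SigOk S) {F d a p τ} (hF : (F, d) ∈ S)
    (h : PatMatch a p τ) : ∀ {Γp B Ω Γ T}, PatCtx F d.ty p Γp B Ω → Typing S Γ a T →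
    ∃ τ', (∀ x R, Ω.getD x none = some R → Tm.env τ x = Tm.env τ' x) ∧
      IsSubst S Γp ∅ Γ ∅ (Tm.env τ') ∧
      DefEq S Γ (avail Γ) (B.subst (Tm.env τ')) T .star .rep := by
  induction h with
  | fam G =>
    intro Γp B Ω Γ T hp ha
    cases hp with
    | const =>
      obtain ⟨hd, hT⟩ := ha.fam_tyEq hS hF
      exact ⟨[], fun _ _ _ => rfl, isSubst_nil ha.ctxOk _, by rwa [hd.subst_of_nil]⟩
  | app a p τ ν b hm ih =>
    intro Γp B Ω Γ T hp ha
    obtain ⟨A₁, B₁, c, hb, hc, harg, hT⟩ := ha.generation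
    have hT := hT.defEq (ha.typing_star hS)
    have hd : Typing S [] d.ty .star := SigWf.typing_ty hS hF
    -- The substitution is extended by `c`, which differs from the written argument `b` when the
    -- latter is `□`.
    have key {Γp A' Ω} (hp : PatCtx F d.ty p Γp (.pi ν.relevance A' B) Ω) :
        ∃ τ', (∀ x R, Ω.getD x none = some R → Tm.env τ x = Tm.env τ' x) ∧
          IsSubst S (.tm A' :: Γp) ∅ Γ ∅ (Tm.env (c :: τ')) ∧
          DefEq S Γ (avail Γ) (B.subst (Tm.env (c :: τ'))) T .star .rep := by
      obtain ⟨τ', h₁, h₂, h₃⟩ := ih hp hb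
      have hpi := (hp.typing_star hd).map hS (isSubstClass_isSubst hS) h₂
      obtain ⟨hc, hB⟩ := hc.pi_conv h₃ hpi
      rw [Tm.subst_env_upSub_inst] at hB
      exact ⟨τ', h₁, h₂.cons hc, .trans _ _ _ _ _ _ _ hB hT⟩
    cases hp with
    | piRole _ _ _ _ _ R hp =>
      obtain ⟨τ', h₁, h₂⟩ := key hp
      cases harg
      refine ⟨_ :: τ', ?_, h₂⟩
      rintro (_ | x) R' hx
      · rfl
      · exact h₁ x R' hx
    | piRel _ _ _ _ _ hp =>
      obtain ⟨τ', h₁, h₂⟩ := key hp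
      cases harg
      refine ⟨_ :: τ', ?_, h₂⟩
      rintro (_ | x) R' hx
      · rfl
      · exact h₁ x R' hx
    | piIrr _ _ _ _ _ hp =>
      obtain ⟨τ', h₁, h₂⟩ := key hp
      refine ⟨c :: τ', ?_, h₂⟩
      rintro (_ | x) R' hx
      · cases hx
      · exact h₁ x R' hx
  | capp a p τ hm ih =>
    intro Γp B Ω Γ T hp ha
    obtain ⟨φ, B₁, hb, hφ, hT⟩ := ha.generation
    have hT := hT.defEq (ha.typing_star hS)
    cases hp with
    | cpi _ _ ψ _ _ hp =>
      obtain ⟨τ', h₁, h₂, h₃⟩ := ih hp hb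
      obtain ⟨hψ, hB⟩ := hφ.cpi_conv (φ := ψ.subst (Tm.env τ')) h₃
      exact ⟨τ', h₁, h₂.consCo hψ, .trans _ _ _ _ _ _ _ hB hT⟩

theorem Typing.axiomStep (hS : SigOk S) {Γ F A Rs p R a b b' T}
    (hF : (F, Decl.ax A Rs p R b) ∈ S) (hm : MatchSubst a p b b') (ha : Typing S Γ a T) :
    Typing S Γ b' T := by
  obtain ⟨τ, hτ, rfl⟩ := hm
  obtain ⟨Γp, B, Ω, -, hp, hb, hR⟩ := SigWf.ax_ok hS hF
  obtain ⟨τ', h₁, h₂, h₃⟩ := hτ.exists_isSubst hS hF hp ha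
  have hb' : b.subst (Tm.env τ) = b.subst (Tm.env τ') := Tm.subst_congr fun x hx => by
    obtain ⟨R', hR'⟩ := hR.getD_of_freeIn hx
    exact h₁ x R' hR'
  rw [hb']
  exact .conv _ _ _ _ (hb.map hS (isSubstClass_isSubst hS) h₂) h₃ (ha.typing_star hS)

/-! ### Branches of a case -/

/-- Applying a branch to the arguments of a path that fits the pattern: the types of the path and
of the branch are instantiated in step, the path taking the place of the pattern. -/
theorem AppsPath.branchTyping (hS : SigOk S) {R R' Γ a F υs} (h : AppsPath S R a F υs) :
    ∀ {υs' b b' a₀ A₀ A₁ B C T}, ApplyArgs a b b' → Typing S Γ a T →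
    Typing S Γ (.fam F) A₁ → Typing S Γ b B →
    BranchTyping (υs ++ υs') R' a₀ A₀ (.fam F) A₁ B C →
    ∃ T' B', DefEq S Γ (avail Γ) T' T .star .rep ∧ Typing S Γ a T' ∧ Typing S Γ b' B' ∧
      BranchTyping υs' R' a₀ A₀ a T' B' C := by
  have base {F} : ∀ {υs b b' a₀ A₀ A₁ B C T}, ApplyArgs (.fam F) b b' →
      Typing S Γ (.fam F) T → Typing S Γ (.fam F) A₁ → Typing S Γ b B →
      BranchTyping ([] ++ υs) R' a₀ A₀ (.fam F) A₁ B C →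
      ∃ T' B', DefEq S Γ (avail Γ) T' T .star .rep ∧ Typing S Γ (.fam F) T' ∧
        Typing S Γ b' B' ∧ BranchTyping υs R' a₀ A₀ (.fam F) T' B' C := by
    intro υs b b' a₀ A₀ A₁ B C T hargs hT hA₁ hb hB
    cases hargs
    obtain ⟨d, hd, -, h₁⟩ := hA₁.generation
    exact ⟨A₁, B, .trans _ _ _ _ _ _ _
      (.symm _ _ _ _ _ _ (hA₁.fam_tyEq hS hd).2) (hT.fam_tyEq hS hd).2, hA₁, hb, hB⟩
  induction h with
  | absConst => exact base
  | const => exact base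
  | app a F υs ν e _ ih =>
    intro υs' b b'' a₀ A₀ A₁ B C T hargs ha hA₁ hb hB
    rw [List.append_assoc] at hB
    obtain ⟨A, D, c, ha', hc, harg, hT⟩ := ha.generation
    have hT := hT.defEq (ha.typing_star hS)
    obtain ⟨b', hargs', hb''⟩ : ∃ b', ApplyArgs a b b' ∧ b'' =
        .app b' (.rho ν.relevance) e := by
      cases hargs with
      | appRole _ _ b' _ _ h => exact ⟨b', h, rfl⟩
      | appRho _ _ b' _ _ h => exact ⟨b', h, rfl⟩
    obtain ⟨T', B', hT', haT', hb', hB'⟩ := ih hargs' ha' hA₁ hb hB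
    -- The shape common to the three rules for an application flag.
    obtain ⟨A₂, B₂, C₂, w, rfl, rfl, hw, hB₂⟩ : ∃ A₂ B₂ C₂ w,
        T' = .pi ν.relevance A₂ B₂ ∧ B' = .pi ν.relevance A₂ C₂ ∧ w.inst c = e ∧
        BranchTyping υs' R' a₀.shift A₀.shift (.app a.shift ν w) B₂ C₂ C.shift := by
      cases hB' with
      | piRole => cases harg; exact ⟨_, _, _, _, rfl, rfl, rfl, ‹_›⟩
      | piRel => cases harg; exact ⟨_, _, _, _, rfl, rfl, rfl, ‹_›⟩
      | piIrrel => cases harg; exact ⟨_, _, _, _, rfl, rfl, rfl, ‹_›⟩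
    obtain ⟨hcA₂, hBc⟩ := hc.pi_conv hT' (haT'.typing_star hS)
    refine ⟨B₂.inst c, C₂.inst c, .trans _ _ _ _ _ _ _ hBc hT, harg.typing haT' hcA₂, ?_, ?_⟩
    · subst hb''
      cases harg with
      | rel => exact .app _ _ _ _ _ hb' hcA₂
      | irr => exact .iapp _ _ _ _ _ hb' hcA₂
      | role => exact .app _ _ _ _ _ hb' hcA₂
    · have := hB₂.subst (Tm.env [c])
      change BranchTyping υs' R' (a₀.shift.inst c) (A₀.shift.inst c)
        (.app (a.shift.inst c) ν (w.inst c)) (B₂.inst c) (C₂.inst c) (C.shift.inst c) at this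
      simpa only [Tm.shift_inst, hw] using this
  | capp a F υs _ ih =>
    intro υs' b b'' a₀ A₀ A₁ B C T hargs ha hA₁ hb hB
    rw [List.append_assoc] at hB
    obtain ⟨φ, D, ha', hφ, hT⟩ := ha.generation
    have hT := hT.defEq (ha.typing_star hS)
    cases hargs with
    | capp _ _ b' hargs' =>
      obtain ⟨T', B', hT', haT', hb', hB'⟩ := ih hargs' ha' hA₁ hb hB
      cases hB' with
      | cPi _ _ _ _ _ ψ D' C' _ hB' =>
        obtain ⟨hψ, hD⟩ := hφ.cpi_conv hT'
        exact ⟨D', C', .trans _ _ _ _ _ _ _ hD hT, .capp _ _ _ _ _ _ _ haT' hψ,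
          .capp _ _ _ _ _ _ _ hb' hψ, hB'⟩

/-- Replacing the scrutinee by an equal one replaces the type of a branch by an equal one. -/
theorem BranchTyping.exists_defEq (hS : SigOk S) {υs R a A w A₁ B C}
    (h : BranchTyping υs R a A w A₁ B C) : ∀ {Γ a'}, DefEq S Γ ∅ a a' A R →
    Typing S Γ a' A → Typing S Γ B .star → Typing S Γ C .star →
    ∃ B', BranchTyping υs R a' A w A₁ B' C ∧ Typing S Γ B' .star ∧
      ∀ Δ, DefEq S Γ Δ B B' .star .rep := by
  have pi {Γ ρ A C C'} (hC : Typing S Γ (.pi ρ A C) .star)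
      (hC' : Typing S (.tm A :: Γ) C' .star)
      (h : ∀ Δ, DefEq S (.tm A :: Γ) Δ C C' .star .rep) :
      Typing S Γ (.pi ρ A C') .star ∧
        ∀ Δ, DefEq S Γ Δ (.pi ρ A C) (.pi ρ A C') .star .rep := by
    have hA := hC.generation.1
    have hpi := Typing.pi _ ρ _ _ hC' hA
    exact ⟨hpi, fun Δ => .piCong _ _ _ _ _ _ _ _ (.refl _ _ _ _ _ hA) (h Δ) hA hC hpi⟩
  -- Only the scrutinee in the final constraint differs, and it does not occur in the telescope.
  induction h with
  | base R a A w C =>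
    intro Γ a' haa' ha' hB hC
    have hφ := hB.generation.1
    cases hφ with
    | wff _ _ _ _ _ ha hw hA =>
      have hφ' : PropOk S Γ ⟨a', w, A, R⟩ := .wff _ _ _ _ _ ha' hw hA
      have hB' := Typing.cpi _ _ _ (hC.weaken_co hS hφ') hφ'
      refine ⟨_, .base _ _ _ _ _, hB', fun Δ => ?_⟩
      exact .cpiCong _ _ ⟨a, w, A, R⟩ ⟨a', w, A, R⟩ _ _ _
        (.propCong _ _ _ _ _ _ _ _ (haa'.mono hS ha.ctxOk (Set.empty_subset _))
          (.refl _ _ _ _ _ hw))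
        (.refl _ _ _ _ _ hB.generation.2) hB.generation.1 hB hB'
  | piRole _ _ _ _ _ _ _ _ _ _ _ ih =>
    intro Γ a' haa' ha' hB hC
    obtain ⟨hA, hC₁⟩ := hB.generation
    obtain ⟨B', h₁, h₂, h₃⟩ := ih (haa'.weaken_tm hS hA subset_rfl) (ha'.weaken_tm hS hA) hC₁
      (hC.weaken_tm hS hA)
    exact ⟨_, .piRole _ _ _ _ _ _ _ _ _ _ h₁, pi hB h₂ h₃⟩
  | piRel _ _ _ _ _ _ _ _ _ _ ih =>
    intro Γ a' haa' ha' hB hC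
    obtain ⟨hA, hC₁⟩ := hB.generation
    obtain ⟨B', h₁, h₂, h₃⟩ := ih (haa'.weaken_tm hS hA subset_rfl) (ha'.weaken_tm hS hA) hC₁
      (hC.weaken_tm hS hA)
    exact ⟨_, .piRel _ _ _ _ _ _ _ _ _ h₁, pi hB h₂ h₃⟩
  | piIrrel _ _ _ _ _ _ _ _ _ _ ih =>
    intro Γ a' haa' ha' hB hC
    obtain ⟨hA, hC₁⟩ := hB.generation
    obtain ⟨B', h₁, h₂, h₃⟩ := ih (haa'.weaken_tm hS hA subset_rfl) (ha'.weaken_tm hS hA) hC₁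
      (hC.weaken_tm hS hA)
    exact ⟨_, .piIrrel _ _ _ _ _ _ _ _ _ h₁, pi hB h₂ h₃⟩
  | cPi _ _ _ _ _ φ _ _ _ _ ih =>
    intro Γ a' haa' ha' hB hC
    obtain ⟨hφ, hC₁⟩ := hB.generation
    have hlift : (∅ : Avail).lift ⊆ ∅ := by rintro _ ⟨c, hc, -⟩; exact hc
    have haφ := haa'.weaken_co hS hφ hlift
    have ha'φ := ha'.weaken_co hS hφ
    obtain ⟨B', h₁, h₂, h₃⟩ := ih haφ ha'φ hC₁ (hC.weaken_co hS hφ)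
    have hB' := Typing.cpi _ φ _ h₂ hφ
    refine ⟨_, .cPi _ _ _ _ _ φ _ _ _ h₁, hB', fun Δ => ?_⟩
    refine .cpiCong _ _ φ φ _ _ _ ?_ (h₃ _) hφ hB hB'
    cases hφ with
    | wff _ _ _ _ _ h₁ h₂ _ =>
      exact .propCong _ _ _ _ _ _ _ _ (.refl _ _ _ _ _ h₁) (.refl _ _ _ _ _ h₂)

/-! ### Reduction -/

theorem RoleCtx.length_rng_cons (o : Option Role) (Ω : RoleCtx) :
    (RoleCtx.rng (o :: Ω)).length = (RoleCtx.rng Ω).length + o.toList.length := by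
  cases o <;> simp [RoleCtx.rng, List.reduceOption]

/-- The roles that a path still expects are those declared for its head, less one for each
relevant argument; these are the arguments of a matching pattern that carry a role. -/
theorem PatMatch.roles_length (hS : SigOk S) {F d a p τ} (hF : (F, d) ∈ S)
    (hm : PatMatch a p τ) : ∀ {Γ A B Ω Rs}, RolePath S a Rs → PatCtx F A p Γ B Ω →
    d.roles.length = (RoleCtx.rng Ω).length + Rs.length := by
  induction hm with
  | fam G =>
    intro Γ A B Ω Rs hr hp
    cases hp
    cases hr with
    | absConst _ _ _ h => obtain rfl := SigWf.decl_unique hS hF h; simp [RoleCtx.rng, Decl.roles]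
    | const _ _ _ _ _ _ h =>
      obtain rfl := SigWf.decl_unique hS hF h; simp [RoleCtx.rng, Decl.roles]
  | app a p τ ν b _ ih =>
    intro Γ A B Ω Rs hr hp
    cases hp with
    | piRole _ _ _ _ _ _ hp =>
      cases hr with
      | tapp _ _ _ _ hr =>
        have := ih hr hp
        simp only [RoleCtx.length_rng_cons, List.length_cons, Option.toList] at this ⊢
        simpa [add_assoc, add_comm] using this
    | piRel _ _ _ _ _ hp =>
      cases hr with
      | app _ _ _ _ hr =>
        have := ih hr hp
        simp only [RoleCtx.length_rng_cons, List.length_cons, Option.toList] at this ⊢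
        simpa [add_assoc, add_comm] using this
    | piIrr _ _ _ _ _ hp =>
      cases hr with
      | iapp _ _ hr => simpa [RoleCtx.length_rng_cons] using ih hr hp
  | capp a p τ _ ih =>
    intro Γ A B Ω Rs hr hp
    cases hp with | cpi _ _ _ _ _ hp => cases hr with | capp _ _ hr => exact ih hr hp

/-- A path that still expects a parameter with a role does not reduce: every axiom needs all the
parameters declared for it. -/
theorem Step.not_rolePath (hS : SigOk S) {R a a'} (h : Step S R a a') :
    ∀ {R' Rs}, ¬ RolePath S a (R' :: Rs) := by
  induction h with
  | absTerm => intro _ _ h; cases h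
  | appLeft _ _ _ _ _ _ ih => intro _ _ h; cases h <;> exact ih ‹_›
  | cappLeft _ _ _ _ ih => intro _ _ h; cases h; exact ih ‹_›
  | pattern => intro _ _ h; cases h
  | prim _ _ _ h =>
    intro R' Rs hr
    cases h with
    | appAbs => cases hr <;> rename_i hr <;> cases hr
    | cappCAbs => cases hr with | capp _ _ hr => cases hr
    | axiomStep F A Rs' p R₁ _ b _ hF hm _ =>
      obtain ⟨τ, hτ, -⟩ := hm
      obtain ⟨Γ, B, Ω, rfl, hp, -, -⟩ := SigWf.ax_ok hS hF
      have := hτ.roles_length hS hF hr hp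
      simp [Decl.roles] at this
    | patternTrue => cases hr
    | patternFalse => cases hr

theorem PatMatch.freeIn {a p τ} (h : PatMatch a p τ) : ∀ {m n}, m < τ.length →
    (Tm.env τ m).FreeIn n → a.FreeIn n := by
  induction h with
  | fam => intro m n h; cases h
  | app _ _ _ _ _ _ ih =>
    intro m n hm h
    cases m with
    | zero => exact .inr h
    | succ m => exact .inl (ih (Nat.lt_of_succ_lt_succ hm) h)
  | capp _ _ _ _ ih => exact ih

theorem ApplyArgs.freeIn {a b b' n} (h : ApplyArgs a b b') :
    b'.FreeIn n → a.FreeIn n ∨ b.FreeIn n := by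
  induction h with
  | const => exact .inr
  | appRole _ _ _ _ _ _ ih => rintro (h | h); exacts [(ih h).imp_left .inl, .inl (.inr h)]
  | appRho _ _ _ _ _ _ ih => rintro (h | h); exacts [(ih h).imp_left .inl, .inl (.inr h)]
  | capp _ _ _ _ ih => exact ih

theorem Beta.freeIn (hS : SigOk S) {R a b n} (h : Beta S R a b) : b.FreeIn n → a.FreeIn n := by
  intro hn
  cases h with
  | appAbs =>
    obtain ⟨_ | m, hm, h⟩ := Tm.exists_freeIn_of_freeIn_subst hn
    · exact .inr h
    · cases h; exact .inl hm
  | cappCAbs => exact hn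
  | axiomStep _ _ _ _ _ _ _ _ hF hm _ =>
    obtain ⟨τ, hτ, rfl⟩ := hm
    obtain ⟨Γ, B, Ω, -, hp, -, hR⟩ := SigWf.ax_ok hS hF
    obtain ⟨m, hm, h⟩ := Tm.exists_freeIn_of_freeIn_subst hn
    exact hτ.freeIn (by rw [hτ.length_eq hp]; exact hR.lt_length_of_freeIn hm) h
  | patternTrue _ _ _ _ _ _ _ h => exact (h.freeIn hn).imp_right .inl
  | patternFalse => exact .inr (.inr hn)

theorem Step.freeIn (hS : SigOk S) {R a b} (h : Step S R a b) :
    ∀ {n}, b.FreeIn n → a.FreeIn n := by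
  induction h with
  | absTerm _ _ _ _ ih => exact ih
  | appLeft _ _ _ _ _ _ ih => exact Or.imp_left ih
  | cappLeft _ _ _ _ ih => exact ih
  | pattern _ _ _ _ _ _ _ _ ih => exact Or.imp_left ih
  | prim _ _ _ h => exact h.freeIn hS

/-- An irrelevant argument does not matter to the body of the abstraction, so the argument `a`
written in the redex may be replaced by the term `c` that it stands for. -/
theorem ArgOk.inst_eq {f ρ a c v} (h : ArgOk S f (.rho ρ) a c) (hv : RhoCheck ρ v) :
    v.inst a = v.inst c := by
  cases h with
  | rel => rfl
  | irr =>
    refine Tm.subst_congr fun x hx => ?_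
    cases x with
    | zero => exact absurd hx hv
    | succ x => rfl

theorem Beta.preservation (hS : SigOk S) {R a a' Γ T} (h : Beta S R a a')
    (ha : Typing S Γ a T) : Typing S Γ a' T := by
  have hTs := ha.typing_star hS
  cases h with
  | appAbs ρ v b hv =>
    obtain ⟨A, B, c, hf, hc, harg, hT⟩ := ha.generation
    obtain ⟨A', B', hv', hA', hρ, hpi⟩ := hf.generation
    have hpi := hpi.defEq (hf.typing_star hS)
    have hpi' := Typing.pi _ ρ _ _ (hv'.typing_star hS) hA'
    obtain ⟨hc', hB⟩ := hc.pi_conv hpi hpi'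
    rw [harg.inst_eq hρ]
    exact .conv _ _ _ _ (hv'.inst hS hc') (.trans _ _ _ _ _ _ _ hB (hT.defEq hTs)) hTs
  | cappCAbs =>
    obtain ⟨φ, B, hb, hφ, hT⟩ := ha.generation
    obtain ⟨ψ, C, hb', hψ, hall⟩ := hb.generation
    obtain ⟨hψ', hB⟩ := hφ.cpi_conv (hall.defEq (hb.typing_star hS))
    exact .conv _ _ _ _ (hb'.instCo hS hψ') (.trans _ _ _ _ _ _ _ hB (hT.defEq hTs)) hTs
  | axiomStep _ _ _ _ _ _ _ _ hF hm _ => exact ha.axiomStep hS hF hm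
  | patternTrue a F υs b₁ b₂ b₁' hp hargs =>
    obtain ⟨A, A₁, B, C, haA, hF, hb₁, hb₂, hB, -, hT⟩ := ha.generation
    rw [← List.append_nil υs] at hB
    obtain ⟨T', B', -, -, hb', hB'⟩ := hp.branchTyping hS hargs haA hF hb₁ hB
    cases hB' with
    | base =>
      exact .conv _ _ _ _ (.capp _ _ _ _ _ _ _ hb' (.refl _ _ _ _ _ haA)) (hT.defEq hTs) hTs
  | patternFalse =>
    obtain ⟨A, A₁, B, C, -, -, -, hb₂, -, -, hT⟩ := ha.generation
    exact .conv _ _ _ _ hb₂ (hT.defEq hTs) hTs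

theorem Step.preservation (hS : SigOk S) {R a a'} (h : Step S R a a') :
    ∀ {Γ T}, Typing S Γ a T → Typing S Γ a' T ∧ ∀ Δ, DefEq S Γ Δ a a' T R := by
  -- It suffices to treat the type given by the syntax-directed rule.
  have conv {Γ a a' R T T'} (hT : TyEq S Γ T' T) (hTs : Typing S Γ T .star)
      (h : Typing S Γ a' T' ∧ ∀ Δ, DefEq S Γ Δ a a' T' R) :
      Typing S Γ a' T ∧ ∀ Δ, DefEq S Γ Δ a a' T R :=
    ⟨.conv _ _ _ _ h.1 (hT.defEq hTs) hTs,
      fun Δ => .eqConv _ _ _ _ _ _ _ (h.2 Δ) (hT.defEq hTs) hTs⟩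
  induction h with
  | absTerm R a a' h ih =>
    intro Γ T ha
    obtain ⟨A, B, hb, hA, hρ, hT⟩ := ha.generation
    obtain ⟨hb', hbb'⟩ := ih hb
    have hρ' : RhoCheck .irr a' := fun hn => hρ (h.freeIn hS hn)
    exact conv hT (ha.typing_star hS) ⟨.abs _ _ _ _ _ hb' hA hρ',
      fun Δ => .absCong _ _ _ _ _ _ _ _ (hbb' Δ) hA hρ hρ'⟩
  | appLeft R a a' ν b h ih =>
    intro Γ T ha
    obtain ⟨A, B, c, hf, hc, harg, hT⟩ := ha.generation
    obtain ⟨hf', hff'⟩ := ih hf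
    refine conv hT (ha.typing_star hS) ?_
    cases harg with
    | rel => exact ⟨.app _ _ _ _ _ hf' hc,
        fun Δ => .appCong _ _ _ _ _ _ _ _ _ (hff' Δ) (.refl _ _ _ _ _ hc)⟩
    | irr => exact ⟨.iapp _ _ _ _ _ hf' hc, fun Δ => .iappCong _ _ _ _ _ _ _ _ (hff' Δ) hc⟩
    -- Typing requires `a` to be a path that still expects a role, and such a path does not step.
    | role _ _ _ hr => exact absurd hr (h.not_rolePath hS)
  | cappLeft R a a' h ih =>
    intro Γ T ha
    obtain ⟨φ, B, hb, hφ, hT⟩ := ha.generation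
    obtain ⟨hb', hbb'⟩ := ih hb
    exact conv hT (ha.typing_star hS) ⟨.capp _ _ _ _ _ _ _ hb' hφ,
      fun Δ => .cappCong _ _ _ _ _ _ _ _ _ _ (hbb' Δ) hφ⟩
  | pattern R a a' F υs b₁ b₂ h ih =>
    intro Γ T ha
    obtain ⟨A, A₁, B, C, haA, hF, hb₁, hb₂, hB, hs, hT⟩ := ha.generation
    obtain ⟨ha', haa'⟩ := ih haA
    obtain ⟨B', hB', hB's, hBB'⟩ := hB.exists_defEq hS (haa' ∅) ha' (hb₁.typing_star hS)
      (hb₂.typing_star hS)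
    have hb₁' := Typing.conv _ _ _ _ hb₁ (hBB' _) hB's
    exact conv hT (ha.typing_star hS) ⟨.caseOf _ _ _ _ _ _ _ _ _ _ ha' hF hb₁' hb₂ hB' hs,
      fun Δ => .patCong _ _ _ _ _ _ _ _ _ _ _ _ _ _ _ _ (haa' Δ) (.refl _ _ _ _ _ hb₁)
        (.refl _ _ _ _ _ hb₂) haA ha' hF hB hB' hb₁ hb₁' (hBB' _) hs⟩
  | prim R a b h =>
    intro Γ T ha
    have hb := h.preservation hS ha
    exact ⟨hb, fun Δ => .beta _ _ _ _ _ _ ha hb h⟩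

end SystemDR

theorem mainTheorem2 (S : SystemDR.Sig) (hS : SystemDR.SigOk S)
    (R : SystemDR.Role) (a a' : SystemDR.Tm) (hstep : SystemDR.Step S R a a')
    (Γ : SystemDR.Context) (A : SystemDR.Tm) (ha : SystemDR.Typing S Γ a A) :
    SystemDR.Typing S Γ a' A ∧
      ∀ Δ : SystemDR.Avail, SystemDR.DefEq S Γ Δ a a' A R :=
  hstep.preservation hS ha
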